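/- Let $G$ be a connected reductive group over a field $k$ with a maximal torus $T$, let $(X^*(T),\Phi;X_*(T),\Phi^\vee)$ be the root datum of $(G_{\bar k},T_{\bar k})$, $W$ its Weyl group, and $\Gamma=\mathrm{Gal}(\bar k/k)$ with its action on the root datum. (Everything below is expressed through the root datum with its $\Gamma$-action, and is asserted for every reduced root datum with an action of a group $\Gamma$ by automorphisms.) *Definitions.* A cocharacter $\mu\in X_*(T)$ is quasi-constant if $\langle\sigma\alpha,\mu\rangle/\langle\alpha,\mu\rangle\in\{-1,0,1\}$ for all $\alpha\in\Phi$ with $\langle\alpha,\mu\rangle\ne0$ and all $\sigma\in W\rtimes\Gamma$; quasi-constant characters are defined in the same way with coroots in place of roots. A ray in a $\mathbf Q$-vector space is the set of nonnegative rational multiples of a nonzero vector; a ray in $X_*(T)_{\mathbf Q}$ or $X^*(T)_{\mathbf Q}$ is quasi-constant if its lattice points are. Let $T^{\rm ad}$ be the image of $T$ in the adjoint group $G^{\rm ad}$, so that $X^*(T^{\rm ad})=\mathbf Z\Phi$ and $X_*(T^{\rm ad})=\mathrm{Hom}(\mathbf Z\Phi,\mathbf Z)$, with the natural maps $\mathrm{pr}_*:X_*(T)_{\mathbf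 Q}\to X_*(T^{\rm ad})_{\mathbf Q}$ and $\mathrm{pr}^*:X^*(T^{\rm ad})_{\mathbf Q}\to X^*(T)_{\mathbf Q}$. For a basis of simple roots $\Delta\subset\Phi$ and $\alpha\in\Delta$, let $\eta(\alpha)\in X^*(T^{\rm ad})_{\mathbf Q}$ and $\eta(\alpha^\vee)\in X_*(T^{\rm ad})_{\mathbf Q}$ be the fundamental weight and coweight (dual to the simple coroots and to the simple roots), and let $D_\Delta:X_*(T^{\rm ad})_{\mathbf Q}\to X^*(T^{\rm ad})_{\mathbf Q}$ be the linear map $\eta(\alpha^\vee)\mapsto\eta(\alpha)$. A vector or ray is $\Delta$-dominant if its pairings with the simple roots (resp. coroots) are $\ge0$. For a ray $\mathfrak r\subset X_*(T)_{\mathbf Q}$, call $\Delta$ adapted to $\mathfrak r$ if the projection of $\mathfrak r$ to each simple factor of $G^{\rm ad}_{\bar k}$ is trivial or contains a fundamental coweight of that factor. Levi subgroups are Levi subgroups $L\supset T$ of $G_{\bar k}$, i.e. centralizers of subtori of $T$; $X^*(L)$ is identified by restriction with the group of $\chi\in X^*(T)$ orthogonal to all coroots of $L$. $\mathrm{Cent}(\mathfrak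 r)$ is the Levi subgroup with roots $\{\alpha\in\Phi:\langle\alpha,\mathfrak r\rangle=0\}$. **Proposition.** Let $\mathfrak r\subset X_*(T)_{\mathbf Q}$ be a quasi-constant ray that is not central (not orthogonal to all roots). There is a $\Delta$ adapted to $\mathfrak r$, and every $\Delta$ for which $\mathfrak r$ is $\Delta$-dominant is adapted. For $\Delta$ adapted to $\mathfrak r$ put $\mathfrak r^\vee_{\rm ad}:=D_\Delta(\mathrm{pr}_*\mathfrak r)$ and $\mathfrak r^\vee:=\mathrm{pr}^*(\mathfrak r^\vee_{\rm ad})$; these do not depend on the choice of the adapted $\Delta$. Then: 1. $\mathfrak r^\vee_{\rm ad}$ is a quasi-constant ray in $X^*(T^{\rm ad})_{\mathbf Q}$. 2. $\mathfrak r^\vee$ is a quasi-constant ray in $X^*(T)_{\mathbf Q}$. 3. $\mathfrak r^\vee$ is the restriction of a ray in $X^*(\mathrm{Cent}(\mathfrak r))_{\mathbf Q}$. 4. $\mathrm{Cent}(\mathfrak r)$ is the largest Levi subgroup $L$ such that $\mathfrak r^\vee$ is the restriction of a ray in $X^*(L)_{\mathbf Q}$. The ray in $X^*(T^{\rm ad})_{\mathbf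 Q}$ spanned by $\sum\eta(\alpha)$, the sum over the $\alpha\in\Delta$ with $\langle\alpha,\mathfrak r\rangle\neq0$ (one $\alpha$ for each simple factor to which $\mathfrak r$ projects nontrivially), and its image under $\mathrm{pr}^*$ are likewise independent of the adapted $\Delta$ and also satisfy 1–4 in place of $\mathfrak r^\vee_{\rm ad}$ and $\mathfrak r^\vee$; this ray is equal to $\mathfrak r^\vee_{\rm ad}$ if $\Gamma$ permutes the simple factors of $G^{\rm ad}_{\bar k}$ transitively. 5. If $G$ is semisimple, then $\mathfrak r\mapsto\mathfrak r^\vee$ is a bijection from the quasi-constant rays in $X_*(T)_{\mathbf Q}$ to those in $X^*(T)_{\mathbf Q}$; moreover, for every $\Delta$, the map $\mathfrak r\mapsto\mathrm{pr}^*D_\Delta(\mathrm{pr}_*\mathfrak r)$ is a bijection from the $\Delta$-dominant quasi-constant rays in $X_*(T)_{\mathbf Q}$ to those in $X^*(T)_{\mathbf Q}$. -/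

import Mathlib

open scoped TensorProduct

noncomputable section

namespace QuasiConstant

/-! ### Rational characters, rational cocharacters and rays -/

section Rational

variable {A : Type*} [AddCommGroup A]

/-- The `ℚ`-linear extension `A_ℚ → ℚ` of an additive functional `A → ℤ`. -/
def ratExt (f : A →ₗ[ℤ] ℤ) : ℚ ⊗[ℤ] A →ₗ[ℚ] ℚ :=
  (TensorProduct.AlgebraTensorModule.rid ℤ ℚ ℚ).toLinearMap ∘ₗ f.baseChange ℚ

@[simp] lemma ratExt_tmul (f : A →ₗ[ℤ] ℤ) (q : ℚ) (a : A) :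
    ratExt f (q ⊗ₜ[ℤ] a) = f a * q := by
  simp [ratExt]

/-- The nonnegative rational multiples of a vector. -/
def span₀ {V : Type*} [AddCommGroup V] [Module ℚ V] (v : V) : Set V :=
  {x | ∃ q : ℚ, 0 ≤ q ∧ x = q • v}

/-- A ray in a `ℚ`-vector space: the set of nonnegative rational multiples of a nonzero vector. -/
def IsRay {V : Type*} [AddCommGroup V] [Module ℚ V] (r : Set V) : Prop :=
  ∃ v : V, v ≠ 0 ∧ r = span₀ v

end Rational

variable {ι X Y Γ : Type*} [AddCommGroup X] [AddCommGroup Y] [Group Γ]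

/-! ### Root data

`P : RootDatum ι X Y` is a root datum with character lattice `X = X^*(T)`, cocharacter lattice
`Y = X_*(T)`, roots `P.root i` and coroots `P.coroot i` (`i : ι`). -/

/-- The value `⟨α_i, μ⟩ ∈ ℚ` for a rational cocharacter `μ`. -/
def rootVal (P : RootDatum ι X Y) (i : ι) : ℚ ⊗[ℤ] Y →ₗ[ℚ] ℚ := ratExt (P.root' i)

/-- The value `⟨χ, α_i^∨⟩ ∈ ℚ` for a rational character `χ`. -/
def corootVal (P : RootDatum ι X Y) (i : ι) : ℚ ⊗[ℤ] X →ₗ[ℚ] ℚ := ratExt (P.coroot' i)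

/-- The permutation of the (co)roots given by an action of `Γ` on the root datum by
automorphisms. -/
def galPerm (P : RootDatum ι X Y) (ρ : Γ →* P.Aut) : Γ →* (ι ≃ ι) :=
  (RootPairing.Equiv.indexHom P).comp ρ

/-- The root datum is semisimple: the roots span `X^*(T)_ℚ`. -/
def IsSemisimple (P : RootDatum ι X Y) : Prop :=
  Submodule.span ℚ (Set.range fun i ↦ (1 : ℚ) ⊗ₜ[ℤ] P.root i) = ⊤

/-! ### Quasi-constant characters, cocharacters and rays

Here `π` is the action of `Γ` on the set of roots (equivalently on the set of coroots);
an element `(w, σ)` of `W ⋊ Γ` sends `α_i^∨` to `α_j^∨` with `j = w (σ i)`. -/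

/-- Quasi-constant characters. -/
def IsQuasiConstantChar (P : RootDatum ι X Y) (π : Γ →* (ι ≃ ι)) (χ : X) : Prop :=
  ∀ i, P.toLinearMap χ (P.coroot i) ≠ 0 → ∀ (w : P.weylGroup) (σ : Γ),
    (P.toLinearMap χ (P.coroot (P.weylGroupToPerm w (π σ i))) : ℚ) /
      (P.toLinearMap χ (P.coroot i) : ℚ) ∈ ({-1, 0, 1} : Set ℚ)

/-- Quasi-constant cocharacters. -/
def IsQuasiConstantCochar (P : RootDatum ι X Y) (π : Γ →* (ι ≃ ι)) (μ : Y) : Prop :=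
  ∀ i, P.toLinearMap (P.root i) μ ≠ 0 → ∀ (w : P.weylGroup) (σ : Γ),
    (P.toLinearMap (P.root (P.weylGroupToPerm w (π σ i))) μ : ℚ) /
      (P.toLinearMap (P.root i) μ : ℚ) ∈ ({-1, 0, 1} : Set ℚ)

/-- Quasi-constant rays in `X^*(T)_ℚ`: rays all of whose lattice points are quasi-constant. -/
def IsQuasiConstantCharRay (P : RootDatum ι X Y) (π : Γ →* (ι ≃ ι)) (r : Set (ℚ ⊗[ℤ] X)) : Prop :=
  IsRay r ∧ ∀ χ : X, (1 : ℚ) ⊗ₜ[ℤ] χ ∈ r → IsQuasiConstantChar P π χ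

/-- Quasi-constant rays in `X_*(T)_ℚ`: rays all of whose lattice points are quasi-constant. -/
def IsQuasiConstantCocharRay (P : RootDatum ι X Y) (π : Γ →* (ι ≃ ι)) (r : Set (ℚ ⊗[ℤ] Y)) :
    Prop :=
  IsRay r ∧ ∀ μ : Y, (1 : ℚ) ⊗ₜ[ℤ] μ ∈ r → IsQuasiConstantCochar P π μ

/-- The rational cocharacters in `r` are central, i.e. orthogonal to all roots. -/
def IsCentral (P : RootDatum ι X Y) (r : Set (ℚ ⊗[ℤ] Y)) : Prop :=
  ∀ μ ∈ r, ∀ i, rootVal P i μ = 0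

/-- An element of the root lattice orthogonal to all simple coroots vanishes. -/
lemma eq_zero_of_coroot_eq_zero [Finite ι] (P : RootDatum ι X Y) (b : P.Base) (z : P.rootSpan ℤ)
    (hz : ∀ j ∈ b.support, P.coroot' j z = 0) : z = 0 := by
  have := Fintype.ofFinite ι
  have key (i : ι) : P.toLinearMap (z : X) (P.coroot i) = 0 := by
    have hi := b.coroot_mem_span_int i
    generalize P.coroot i = c at hi
    induction hi using Submodule.span_induction with
    | mem y hy =>
      obtain ⟨j, hj, rfl⟩ := hy
      exact hz j hj
    | zero => simp
    | add x y _ _ hx hy => simp [hx, hy]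
    | smul a x _ hx => simp [hx]
  refine Subtype.ext (P.eq_zero_of_mem_rootSpan_of_rootForm_self_eq_zero z.2 ?_)
  rw [P.rootForm_apply_apply]
  exact Finset.sum_eq_zero fun i _ ↦ by simp [key i]

/-! ### The root datum of the adjoint quotient

`X^*(T^ad)` is the root lattice and `X_*(T^ad)` is its dual. -/

section Adjoint

variable [Finite ι] [Module.Finite ℤ X]

lemma isReflexive_rootSpan (P : RootDatum ι X Y) : Module.IsReflexive ℤ (P.rootSpan ℤ) := by
  have : Module.IsReflexive ℤ X := .of_isPerfPair P.toLinearMap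
  have : Module.Free ℤ X := Module.free_of_finite_type_torsion_free'
  infer_instance

/-- The root datum of `(G^ad, T^ad)`. -/
def adjoint (P : RootDatum ι X Y) :
    RootDatum ι (P.rootSpan ℤ) (Module.Dual ℤ (P.rootSpan ℤ)) :=
  have := isReflexive_rootSpan P
  { toLinearMap := Module.Dual.eval ℤ (P.rootSpan ℤ)
    isPerfPair_toLinearMap := .dualEval
    root := ⟨P.rootSpanMem ℤ, fun i j h ↦ P.root.injective (congrArg Subtype.val h)⟩
    coroot := ⟨fun i ↦ (P.coroot' i) ∘ₗ (P.rootSpan ℤ).subtype, fun i j h ↦ by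
      have : Module.IsReflexive ℤ X := .of_isPerfPair P.toLinearMap
      have hX : IsAddTorsionFree X :=
        Module.isTorsionFree_int_iff_isAddTorsionFree.mp inferInstance
      exact P.coroot.injective (P.injOn_dualMap_subtype_span_root_coroot
        (Set.mem_range_self i) (Set.mem_range_self j) h)⟩
    root_coroot_two := fun i ↦ P.root_coroot_two i
    reflectionPerm := P.reflectionPerm
    reflectionPerm_root := fun i j ↦ Subtype.ext (P.reflectionPerm_root i j)
    reflectionPerm_coroot := fun i j ↦ by
      ext x
      have h := congrArg (P.toLinearMap x) (P.reflectionPerm_coroot i j)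
      rw [map_sub, map_smul] at h
      exact h }

/-- The map `pr^* : X^*(T^ad)_ℚ → X^*(T)_ℚ` induced by `T → T^ad`. -/
def prPull (P : RootDatum ι X Y) : ℚ ⊗[ℤ] P.rootSpan ℤ →ₗ[ℚ] ℚ ⊗[ℤ] X :=
  (P.rootSpan ℤ).subtype.baseChange ℚ

/-- The map `pr_* : X_*(T)_ℚ → X_*(T^ad)_ℚ` induced by `T → T^ad`. -/
def prPush (P : RootDatum ι X Y) : ℚ ⊗[ℤ] Y →ₗ[ℚ] ℚ ⊗[ℤ] Module.Dual ℤ (P.rootSpan ℤ) :=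
  ((P.rootSpan ℤ).subtype.dualMap ∘ₗ P.toLinearMap.flip).baseChange ℚ

/-! ### Fundamental weights and the duality -/

/-- A vector of `X^*(T^ad)_ℚ` is determined by its values on the simple coroots, which are
arbitrary. -/
lemma existsUnique_fundWeight (P : RootDatum ι X Y) (b : P.Base) (f : b.support → ℚ) :
    ∃! η : ℚ ⊗[ℤ] P.rootSpan ℤ, ∀ j : b.support, corootVal (adjoint P) j η = f j := by
  let B := b.toWeightBasisInt.baseChange ℚ
  let L : ℚ ⊗[ℤ] P.rootSpan ℤ →ₗ[ℚ] (b.support → ℚ) :=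
    LinearMap.pi fun j ↦ corootVal (adjoint P) j
  have hfin : Module.Finite ℚ (ℚ ⊗[ℤ] P.rootSpan ℤ) := .of_basis B
  have hinj : Function.Injective L := by
    rw [injective_iff_map_eq_zero]
    intro x hx
    obtain ⟨⟨z, n⟩, hn⟩ := IsLocalizedModule.surj (nonZeroDivisors ℤ)
      (TensorProduct.mk ℤ ℚ (P.rootSpan ℤ) 1) x
    have hz : z = 0 := by
      refine eq_zero_of_coroot_eq_zero P b z fun j hj ↦ ?_
      have h1 : corootVal (adjoint P) j x = 0 := congrFun hx ⟨j, hj⟩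
      have h2 := congrArg (corootVal (adjoint P) j) hn
      have h3 : corootVal (adjoint P) j (n • x) = 0 := by
        change corootVal (adjoint P) j ((n : ℤ) • x) = 0
        rw [map_zsmul, h1, smul_zero]
      rw [h3] at h2
      have h4 : (0 : ℚ) = ((P.coroot' j z : ℤ) : ℚ) := by
        rw [corootVal, TensorProduct.mk_apply, ratExt_tmul, mul_one] at h2
        exact h2
      exact_mod_cast h4.symm
    have hn' : (n : ℤ) • x = 0 := by
      have : (n : ℤ) • x = (1 : ℚ) ⊗ₜ[ℤ] z := hn
      rw [this, hz, TensorProduct.tmul_zero]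
    rw [← Int.cast_smul_eq_zsmul ℚ] at hn'
    exact (smul_eq_zero.mp hn').resolve_left
      (by exact_mod_cast nonZeroDivisors.coe_ne_zero n)
  have hbij : Function.Bijective L := ⟨hinj,
    (LinearMap.injective_iff_surjective_of_finrank_eq_finrank
      (by simp [Module.finrank_eq_card_basis B])).mp hinj⟩
  obtain ⟨η, hη, huniq⟩ := hbij.existsUnique f
  exact ⟨η, fun j ↦ congrFun hη j, fun y hy ↦ huniq y (funext hy)⟩

open Classical in
/-- The fundamental weight `η(α_i) ∈ X^*(T^ad)_ℚ` attached to a simple root `α_i`: the unique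
vector with `⟨η(α_i), α_i^∨⟩ = 1` and `⟨η(α_i), α_j^∨⟩ = 0` for the other simple roots `α_j`. -/
def fundWeight (P : RootDatum ι X Y) (b : P.Base) (i : b.support) : ℚ ⊗[ℤ] P.rootSpan ℤ :=
  (existsUnique_fundWeight P b fun j ↦ if j = i then 1 else 0).choose

open Classical in
lemma corootVal_fundWeight (P : RootDatum ι X Y) (b : P.Base) (i j : b.support) :
    corootVal (adjoint P) j (fundWeight P b i) = if j = i then 1 else 0 :=
  (existsUnique_fundWeight P b fun j ↦ if j = i then 1 else 0).choose_spec.1 j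

/-- The linear map `X_*(T^ad)_ℚ → X^*(T^ad)_ℚ` sending each fundamental coweight to the
corresponding fundamental weight; the coefficient of the fundamental coweight `η(α_i^∨)` in `ν` is
`⟨α_i, ν⟩`. -/
def coweightToWeight (P : RootDatum ι X Y) (b : P.Base) :
    ℚ ⊗[ℤ] Module.Dual ℤ (P.rootSpan ℤ) →ₗ[ℚ] ℚ ⊗[ℤ] P.rootSpan ℤ :=
  ∑ i : b.support, (rootVal (adjoint P) (i : ι)).smulRight (fundWeight P b i)

open Classical in
/-- The linear map `coweightToWeight` does send fundamental coweights to fundamental weights. -/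
lemma coweightToWeight_apply (P : RootDatum ι X Y) (b : P.Base) (i : b.support)
    (ν : ℚ ⊗[ℤ] Module.Dual ℤ (P.rootSpan ℤ))
    (hν : ∀ j : b.support, rootVal (adjoint P) j ν = if j = i then 1 else 0) :
    coweightToWeight P b ν = fundWeight P b i := by
  simp [coweightToWeight, hν]

end Adjoint

/-- The set `Φ_c` of (indices of) roots of the simple factor of the adjoint group (over the
algebraic closure) that contains the root `α_c`: the irreducible component of `α_c`. -/
def component (P : RootDatum ι X Y) (c : ι) : Set ι :=
  {j | Relation.EqvGen (fun i j ↦ P.pairing i j ≠ 0) c j}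

/-- The basis `b` of simple roots is adapted to `r`: the projection of `r` to each simple factor of
the adjoint group is trivial, or contains a fundamental coweight of this factor. The cocharacters
of a factor are determined by their pairings with the simple roots of that factor. -/
def IsAdapted (P : RootDatum ι X Y) (b : P.Base) (r : Set (ℚ ⊗[ℤ] Y)) : Prop :=
  ∀ c : ι, (∀ μ ∈ r, ∀ j ∈ component P c, rootVal P j μ = 0) ∨
    ∃ i ∈ b.support, i ∈ component P c ∧ ∃ μ ∈ r, rootVal P i μ = 1 ∧
      ∀ j ∈ b.support, j ∈ component P c → j ≠ i → rootVal P j μ = 0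

/-- `Δ`-dominant sets of rational cocharacters. -/
def IsDominantCochar (P : RootDatum ι X Y) (b : P.Base) (r : Set (ℚ ⊗[ℤ] Y)) : Prop :=
  ∀ μ ∈ r, ∀ i ∈ b.support, 0 ≤ rootVal P i μ

/-- `Δ`-dominant sets of rational characters. -/
def IsDominantChar (P : RootDatum ι X Y) (b : P.Base) (r : Set (ℚ ⊗[ℤ] X)) : Prop :=
  ∀ χ ∈ r, ∀ i ∈ b.support, 0 ≤ corootVal P i χ

section Dual

variable [Finite ι] [Module.Finite ℤ X]

/-- The dual ray `r_ad^∨ ⊆ X^*(T^ad)_ℚ` relative to `b`: the image of `pr_*(r)` under the linear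
map that replaces fundamental coweights by fundamental weights. -/
def dualRayAd (P : RootDatum ι X Y) (b : P.Base) (r : Set (ℚ ⊗[ℤ] Y)) :
    Set (ℚ ⊗[ℤ] P.rootSpan ℤ) :=
  (fun μ ↦ coweightToWeight P b (prPush P μ)) '' r

open Classical in
/-- The ray in `X^*(T^ad)_ℚ` spanned by the sum of the fundamental weights `η(α_i)`, `α_i` simple
with `⟨α_i, r⟩ ≠ 0`. If `b` is adapted to `r`, there is exactly one such `α_i` for each simple
factor to which `r` projects nontrivially, and none for the other factors. -/
def unitDualRayAd (P : RootDatum ι X Y) (b : P.Base) (r : Set (ℚ ⊗[ℤ] Y)) :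
    Set (ℚ ⊗[ℤ] P.rootSpan ℤ) :=
  span₀ (∑ i : b.support, if ∃ μ ∈ r, rootVal P (i : ι) μ ≠ 0 then fundWeight P b i else 0)

/-- The dual ray `r^∨ = pr^*(r_ad^∨) ⊆ X^*(T)_ℚ`, computed with any basis of simple roots that is
adapted to `r`. -/
def dualRay (P : RootDatum ι X Y) (r : Set (ℚ ⊗[ℤ] Y)) : Set (ℚ ⊗[ℤ] X) :=
  {χ | ∃ b : P.Base, IsAdapted P b r ∧ χ ∈ prPull P '' dualRayAd P b r}

end Dual

/-! ### Levi subgroups containing `T` -/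

/-- A Levi subgroup `L ⊇ T`, recorded by its set of roots: it is the centralizer of a subtorus of
`T` (of the cocharacters in a subgroup `S` of `X_*(T)`), and its roots are those orthogonal
to `S`. The root datum of `(L, T)` has the lattices of `P`, the roots `α_i` and the coroots
`α_i^∨` with `i ∈ roots`. -/
structure Levi (P : RootDatum ι X Y) where
  /-- The (indices of the) roots of the Levi subgroup. -/
  roots : Set ι
  exists_subtorus : ∃ S : AddSubgroup Y, roots = {i | ∀ ν ∈ S, P.toLinearMap (P.root i) ν = 0}

/-- The character group `X^*(L)`, as a subgroup of `X^*(T)` by restriction: the characters of `T`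
that are orthogonal to all coroots of `L`. -/
def Levi.characters {P : RootDatum ι X Y} (L : Levi P) : Submodule ℤ X :=
  ⨅ i ∈ L.roots, LinearMap.ker (P.coroot' i)

/-- The Levi subgroup `Cent(r)`, the centralizer of the cocharacters contained in `r`. -/
def cent (P : RootDatum ι X Y) (r : Set (ℚ ⊗[ℤ] Y)) : Levi P where
  roots := {i | ∀ ν : Y, (1 : ℚ) ⊗ₜ[ℤ] ν ∈ r → P.toLinearMap (P.root i) ν = 0}
  exists_subtorus := by
    refine ⟨AddSubgroup.closure {ν | (1 : ℚ) ⊗ₜ[ℤ] ν ∈ r}, Set.ext fun i ↦ ⟨fun h ν hν ↦ ?_,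
      fun h ν hν ↦ h ν (AddSubgroup.subset_closure hν)⟩⟩
    induction hν using AddSubgroup.closure_induction with
    | mem x hx => exact h x hx
    | zero => simp
    | add x y _ _ hx hy => simp [hx, hy]
    | neg x _ hx => simp [hx]

/-- The set `s ⊆ X^*(T)_ℚ` is the restriction to `T` of a ray in `X^*(L)_ℚ`. -/
def IsRestrictionOfRay {P : RootDatum ι X Y} (L : Levi P) (s : Set (ℚ ⊗[ℤ] X)) : Prop :=
  ∃ t : Set (ℚ ⊗[ℤ] L.characters), IsRay t ∧ L.characters.subtype.baseChange ℚ '' t = s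

/-- The four properties of a ray `s ⊆ X^*(T^ad)_ℚ` dual to `r`: the rays `s` and `pr^*(s)` are
quasi-constant, `pr^*(s)` is the restriction of a ray of characters of `Cent(r)`, and `Cent(r)` is
the largest Levi subgroup with this property. -/
structure HasDualProperties [Finite ι] [Module.Finite ℤ X] (P : RootDatum ι X Y)
    (π : Γ →* (ι ≃ ι)) (r : Set (ℚ ⊗[ℤ] Y)) (s : Set (ℚ ⊗[ℤ] P.rootSpan ℤ)) : Prop where
  quasiConstant_ad : IsQuasiConstantCharRay (adjoint P) π s
  quasiConstant : IsQuasiConstantCharRay P π (prPull P '' s)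
  restriction : IsRestrictionOfRay (cent P r) (prPull P '' s)
  maximal : ∀ L : Levi P, IsRestrictionOfRay L (prPull P '' s) → L.roots ⊆ (cent P r).roots

end QuasiConstant

end

open QuasiConstant

noncomputable section

namespace QuasiConstant

/-! ### Clearing denominators, and rays. -/

section Lattice

variable {A : Type*} [AddCommGroup A]

/-! Let `v` span the ray and be dominant for a base `b`; one exists by `exists_base_dominant`. Every
root `i` has a Weyl conjugate in which all simple roots of its component occur with coefficients at
least 1 (`exists_mem_orbit_full_support`). If `v` is nonzero on the component, its value there is a
positive sum, so quasi-constancy forces this sum to equal any positive value of `v` on the orbit.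
Hence `v` is nonzero on at most one simple root `k` of each component, which is adaptedness.
Comparing such roots `i`, `k` in components conjugate under `Γ`, possibly for different bases, gives
equal values of `v` and equal root lengths (`rootVal_eq_and_rootLen_eq`).

Lengths enter because the coefficient of `k` in the coroot of `i` is its coefficient in the root of
`i` times `rootLen k / rootLen i`. So on a component the dual vector has coroot values proportional
to the root values of `v`, with factor `rootLen k * φ c / (rootLen i * c)`, where `c` is the value
of `v` on `k` (`corootVal_dualVec_eq`). This factor is positive, independent of the dominant base
and constant on `W ⋊ Γ`-orbits, which yields independence, quasi-constancy and the statements on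
`Cent`. Both dual rays are treated at once: `φ = id` gives `dualRayAd`, `φ = nonzeroIndicator` gives
`unitDualRayAd`.

In the semisimple case vectors are determined by their values on simple (co)roots, and the
construction for `P.flip` is the inverse. -/

lemma exists_pos_smul_eq_one_tmul (x : ℚ ⊗[ℤ] A) :
    ∃ n : ℤ, 0 < n ∧ ∃ a : A, (n : ℚ) • x = (1 : ℚ) ⊗ₜ[ℤ] a := by
  obtain ⟨⟨a, n⟩, hn⟩ := IsLocalizedModule.surj (nonZeroDivisors ℤ) (TensorProduct.mk ℤ ℚ A 1) x
  have hn' : ((n : ℤ) : ℚ) • x = (1 : ℚ) ⊗ₜ[ℤ] a := by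
    rw [Int.cast_smul_eq_zsmul]
    exact hn
  rcases lt_or_gt_of_ne (nonZeroDivisors.coe_ne_zero n) with h | h
  · refine ⟨-n, by lia, -a, ?_⟩
    rw [Int.cast_neg, neg_smul, hn', TensorProduct.tmul_neg]
  · exact ⟨n, h, a, hn'⟩

lemma ratExt_zsmul (n : ℤ) (f : A →ₗ[ℤ] ℤ) : ratExt (n • f) = (n : ℚ) • ratExt f := by
  ext; simp

lemma ratExt_sum {κ : Type*} (s : Finset κ) (f : κ → A →ₗ[ℤ] ℤ) :
    ratExt (∑ k ∈ s, f k) = ∑ k ∈ s, ratExt (f k) := by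
  ext; simp

lemma ratExt_baseChange {B : Type*} [AddCommGroup B] (f : B →ₗ[ℤ] ℤ) (h : A →ₗ[ℤ] B)
    (x : ℚ ⊗[ℤ] A) : ratExt f (h.baseChange ℚ x) = ratExt (f ∘ₗ h) x := by
  induction x with
  | zero => simp
  | tmul q a => simp
  | add x y hx hy => simp [hx, hy]

end Lattice

section Rays

variable {V V' : Type*} [AddCommGroup V] [Module ℚ V] [AddCommGroup V'] [Module ℚ V']

lemma self_mem_span₀ (v : V) : v ∈ span₀ v := ⟨1, zero_le_one, (one_smul _ _).symm⟩

lemma image_span₀ (f : V →ₗ[ℚ] V') (v : V) : f '' span₀ v = span₀ (f v) := by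
  ext x
  constructor
  · rintro ⟨-, ⟨q, hq, rfl⟩, rfl⟩
    exact ⟨q, hq, map_smul ..⟩
  · rintro ⟨q, hq, rfl⟩
    exact ⟨q • v, ⟨q, hq, rfl⟩, map_smul ..⟩

lemma span₀_smul {q : ℚ} (hq : 0 < q) (v : V) : span₀ (q • v) = span₀ v := by
  ext x
  constructor
  · rintro ⟨p, hp, rfl⟩
    exact ⟨p * q, by positivity, smul_smul ..⟩
  · rintro ⟨p, hp, rfl⟩
    exact ⟨p / q, by positivity, by rw [smul_smul, div_mul_cancel₀ _ hq.ne']⟩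

end Rays

/-! ### Existence of a base making a given cocharacter dominant. -/

section BaseExists

variable {ι X Y : Type*} [AddCommGroup X] [AddCommGroup Y] [Finite ι]

/-- Twice the co-polarization sends each coroot to a positive multiple of its root, so a relation
among coroots becomes one among roots. -/
lemma linearIndepOn_coroot_of_root (P : RootDatum ι X Y) {s : Set ι}
    (hs : LinearIndepOn ℤ P.root s) : LinearIndepOn ℤ P.coroot s := by
  have := Fintype.ofFinite ι
  rw [linearIndepOn_iff'] at hs ⊢
  intro t g hts hg i hi
  have h1 : ∑ k ∈ t, (g k * P.CorootForm (P.coroot k) (P.coroot k)) • P.root k = 0 := by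
    have := congrArg (fun z ↦ 2 • P.CoPolarization z) hg
    simp only [map_sum, map_smul, map_zero, smul_zero, Finset.smul_sum] at this
    rw [← this]
    refine Finset.sum_congr rfl fun k _ ↦ ?_
    rw [mul_smul, P.corootForm_self_smul_root, smul_comm]
  have h2 := hs t _ hts h1 i hi
  refine (mul_eq_zero.mp h2).resolve_right ?_
  exact (P.flip.rootForm_pos_of_ne_zero (Submodule.subset_span (Set.mem_range_self i))
    (P.flip.ne_zero i)).ne'

lemma exists_sum_of_mem_closure {κ M : Type*} [AddCommGroup M] (v : κ → M) (s : Finset κ) {x : M}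
    (hx : x ∈ AddSubmonoid.closure (v '' s)) :
    ∃ n : κ → ℤ, (∀ j, 0 ≤ n j) ∧ x = ∑ j ∈ s, n j • v j := by
  classical
  induction hx using AddSubmonoid.closure_induction with
  | mem x hx =>
    obtain ⟨j, hj, rfl⟩ := hx
    refine ⟨Pi.single j 1, fun k ↦ ?_, ?_⟩
    · by_cases h : k = j
      · subst h; simp
      · simp [h]
    · rw [Finset.sum_eq_single_of_mem j hj (by simp_all)]
      simp
  | zero => exact ⟨0, by simp, by simp⟩
  | add x y _ _ hx hy =>
    obtain ⟨n, hn, rfl⟩ := hx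
    obtain ⟨m, hm, rfl⟩ := hy
    exact ⟨n + m, fun j ↦ add_nonneg (hn j) (hm j), by simp [add_smul, Finset.sum_add_distrib]⟩

/-- If every root is, up to sign, a nonnegative combination of a linearly independent set of roots,
then the same holds for the coroots. -/
lemma coroot_mem_closure_of_root_mem_closure (P : RootDatum ι X Y) [P.IsReduced] (s : Finset ι)
    (hs : LinearIndepOn ℤ P.root s) (f : X →ₗ[ℤ] ℤ) (hf : ∀ i ∈ s, 0 < f (P.root i))
    (hsp : ∀ i, P.root i ∈ AddSubmonoid.closure (P.root '' s) ∨
      -P.root i ∈ AddSubmonoid.closure (P.root '' s)) (i : ι)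
    (hi : P.root i ∈ AddSubmonoid.closure (P.root '' s)) :
    P.coroot i ∈ AddSubmonoid.closure (P.coroot '' s) := by
  classical
  -- Induction on the value of `f`, which serves as a height: reflecting in some `k ∈ s` with
  -- positive pairing lowers it and changes the coroot by a nonnegative multiple of `P.coroot k`.
  have key (N : ℕ) : ∀ i, P.root i ∈ AddSubmonoid.closure (P.root '' s) →
      f (P.root i) ≤ N → P.coroot i ∈ AddSubmonoid.closure (P.coroot '' s) := by
    induction N with
    | zero =>
      intro i hi hN
      exfalso
      obtain ⟨n, hn, hin⟩ := exists_sum_of_mem_closure P.root s hi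
      have h0 : ∀ j ∈ s, n j * f (P.root j) = 0 := by
        have : ∑ j ∈ s, n j * f (P.root j) = 0 := by
          refine le_antisymm ?_ (Finset.sum_nonneg fun j hj ↦ mul_nonneg (hn j) (hf j hj).le)
          rw [hin] at hN
          simpa using hN
        exact (Finset.sum_eq_zero_iff_of_nonneg
          fun j hj ↦ mul_nonneg (hn j) (hf j hj).le).mp this
      refine P.ne_zero i (hin.trans (Finset.sum_eq_zero fun j hj ↦ ?_))
      rw [(mul_eq_zero.mp (h0 j hj)).resolve_right (hf j hj).ne', zero_smul]
    | succ N ih =>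
      intro i hi hN
      obtain ⟨n, hn, hin⟩ := exists_sum_of_mem_closure P.root s hi
      obtain ⟨k, hk, hki⟩ : ∃ k ∈ s, 0 < P.pairing k i := by
        by_contra! contra
        have h2 : P.pairing i i = ∑ j ∈ s, n j * P.pairing j i := by
          rw [← P.root_coroot_eq_pairing, hin]
          simp
        rw [P.pairing_same] at h2
        have : ∑ j ∈ s, n j * P.pairing j i ≤ 0 :=
          Finset.sum_nonpos fun j hj ↦ mul_nonpos_of_nonneg_of_nonpos (hn j) (contra j hj)
        lia
      by_cases hik : i = k
      · subst hik
        exact AddSubmonoid.subset_closure ⟨i, hk, rfl⟩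
      have hik' : 0 < P.pairing i k := by
        have h1 := P.algebraMap_pairingIn ℤ k i
        have h2 := P.algebraMap_pairingIn ℤ i k
        simp only [Algebra.algebraMap_self, RingHom.id_apply] at h1 h2
        rw [← h1, P.zero_lt_pairingIn_iff'] at hki
        rwa [← h2]
      have hr := P.reflectionPerm_root k i
      have hc := P.reflectionPerm_coroot k i
      rw [P.root_coroot_eq_pairing] at hr hc
      -- If the reflected root were negative, comparing coefficients would leave only `k` in the
      -- expansion of `i`, and reducedness would give `i = k`.
      have hpos : P.root (P.reflectionPerm k i) ∈ AddSubmonoid.closure (P.root '' s) := by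
        refine (hsp _).resolve_right fun hneg ↦ hik ?_
        obtain ⟨m, hm, hkm⟩ := exists_sum_of_mem_closure P.root s hneg
        have hsum : ∑ j ∈ s, (n j + m j - (Pi.single k (P.pairing i k) : ι → ℤ) j) • P.root j
            = 0 := by
          simp only [sub_smul, add_smul, Finset.sum_sub_distrib, Finset.sum_add_distrib]
          rw [← hin, ← hkm, Finset.sum_eq_single_of_mem k hk (by simp_all), Pi.single_eq_same,
            ← hr]
          abel
        have h0 := linearIndepOn_iff'.mp hs s _ subset_rfl hsum
        have hn0 : ∀ j ∈ s, j ≠ k → n j = 0 := by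
          intro j hj hjk
          have := h0 j hj
          rw [Pi.single_eq_of_ne hjk] at this
          have := hn j
          have := hm j
          lia
        have hi' : P.root i = n k • P.root k := by
          rw [hin]
          exact Finset.sum_eq_single_of_mem k hk fun j hj hjk ↦ by rw [hn0 j hj hjk, zero_smul]
        have hnot : ¬ LinearIndependent ℤ ![P.root i, P.root k] := by
          simp_rw [LinearIndependent.pair_iff, not_forall]
          exact ⟨1, -n k, by simp [hi'], by simp⟩
        rcases RootPairing.IsReduced.eq_or_eq_neg i k hnot with h | h
        · exact P.root.injective h
        · exfalso
          have h1 := hf k hk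
          have h2 : f (P.root i) = n k * f (P.root k) := by rw [hi']; simp
          rw [h, map_neg] at h2
          have := mul_nonneg (hn k) h1.le
          lia
      have hlt : f (P.root (P.reflectionPerm k i)) ≤ N := by
        rw [← hr, map_sub, map_smul, smul_eq_mul]
        have := mul_pos hik' (hf k hk)
        push_cast at hN
        lia
      have := ih _ hpos hlt
      have hci : P.coroot i = P.coroot (P.reflectionPerm k i) + P.pairing k i • P.coroot k := by
        rw [← hc]; abel
      rw [hci]
      refine add_mem this ?_
      obtain ⟨p, hp⟩ := Int.eq_ofNat_of_zero_le hki.le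
      rw [hp, natCast_zsmul]
      exact nsmul_mem (AddSubmonoid.subset_closure (Set.mem_image_of_mem _ hk)) p
  exact key (f (P.root i)).toNat i hi (Int.self_le_toNat _)

/-- Perturb `v` by a vector `u` off all root hyperplanes: a lattice multiple of `N • v + u` is
regular and, for large `N`, has the sign of `v` on every root where `v` is nonzero. -/
lemma exists_regular (P : RootDatum ι X Y) (v : ℚ ⊗[ℤ] Y) :
    ∃ y : Y, ∀ i, P.root' i y ≠ 0 ∧ (0 < P.root' i y → 0 ≤ rootVal P i v) := by
  have := Fintype.ofFinite ι
  obtain ⟨u, hu⟩ := Module.Dual.exists_forall_ne_zero_of_forall_exists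
    (fun i ↦ rootVal P i) fun i ↦ ⟨(1 : ℚ) ⊗ₜ[ℤ] P.coroot i, by simp [rootVal]⟩
  let N : ℚ := ∑ i, |rootVal P i u| / |rootVal P i v| + 1
  have hN (i : ι) (hi : rootVal P i v ≠ 0) : |rootVal P i u| < N * |rootVal P i v| := by
    rw [← div_lt_iff₀ (abs_pos.mpr hi)]
    have := Finset.single_le_sum (f := fun i ↦ |rootVal P i u| / |rootVal P i v|)
      (fun i _ ↦ by positivity) (Finset.mem_univ i)
    simp only [N]
    linarith
  obtain ⟨n, hn, y, hy⟩ := exists_pos_smul_eq_one_tmul (N • v + u)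
  have hn' : (0 : ℚ) < n := by exact_mod_cast hn
  refine ⟨y, fun i ↦ ?_⟩
  have hyi : ((P.root' i y : ℤ) : ℚ) = n * (N * rootVal P i v + rootVal P i u) := by
    have := congrArg (rootVal P i) hy
    simp only [map_smul, map_add, smul_eq_mul] at this
    rw [this]
    simp [rootVal]
  rcases lt_trichotomy (rootVal P i v) 0 with h | h | h
  · have h1 := hN i h.ne
    rw [abs_of_neg h] at h1
    have h2 := le_abs_self (rootVal P i u)
    have : ((P.root' i y : ℤ) : ℚ) < 0 := by
      rw [hyi]
      exact mul_neg_of_pos_of_neg hn' (by linarith)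
    have : P.root' i y < 0 := by exact_mod_cast this
    exact ⟨this.ne, fun h ↦ by lia⟩
  · refine ⟨fun h0 ↦ ?_, fun _ ↦ h.ge⟩
    rw [h0, h] at hyi
    simp only [Int.cast_zero, mul_zero, zero_add, zero_eq_mul] at hyi
    exact hyi.elim hn'.ne' (hu i)
  · have h1 := hN i h.ne'
    rw [abs_of_pos h] at h1
    have h2 := neg_abs_le (rootVal P i u)
    have : (0 : ℚ) < ((P.root' i y : ℤ) : ℚ) := by
      rw [hyi]
      exact mul_pos hn' (by linarith)
    have : 0 < P.root' i y := by exact_mod_cast this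
    exact ⟨this.ne', fun _ ↦ h.le⟩

/-- Every rational cocharacter is dominant for some base. -/
theorem exists_base_dominant (P : RootDatum ι X Y) [P.IsReduced] (v : ℚ ⊗[ℤ] Y) :
    ∃ b : P.Base, ∀ i ∈ b.support, 0 ≤ rootVal P i v := by
  obtain ⟨y, hy⟩ := exists_regular P v
  let f : Module.Dual ℤ X := P.toLinearMap.flip y
  have hf (i : ι) : f (P.root i) ≠ 0 := (hy i).1
  let := P.indexNeg
  -- The simple roots are the indecomposable elements among the roots positive on the regular
  -- cocharacter `y`.
  let s := IsAddIndecomposable.baseOf P.root (f : X →+ ℤ)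
  have hs : LinearIndepOn ℤ P.root s := P.linearIndepOn_root_baseOf' f hf
  have hsp (i : ι) : P.root i ∈ AddSubmonoid.closure (P.root '' s) ∨
      -P.root i ∈ AddSubmonoid.closure (P.root '' s) :=
    IsAddIndecomposable.mem_or_neg_mem_closure_baseOf P.root (f : X →+ ℤ) i (hf i) (by simp)
  have hpos (i : ι) (hi : i ∈ s) : 0 < f (P.root i) :=
    IsAddIndecomposable.baseOf_subset_pos P.root (f : X →+ ℤ) hi
  let t : Finset ι := (Set.toFinite s).toFinset
  have ht : (t : Set ι) = s := (Set.toFinite s).coe_toFinset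
  have hmem (i : ι) : i ∈ t ↔ i ∈ s := Set.Finite.mem_toFinset _
  have hco (i : ι) (hi : P.root i ∈ AddSubmonoid.closure (P.root '' s)) :
      P.coroot i ∈ AddSubmonoid.closure (P.coroot '' s) := by
    have := coroot_mem_closure_of_root_mem_closure P t (ht ▸ hs) f
      (fun i hi ↦ hpos i ((hmem i).mp hi)) (ht ▸ hsp) i (ht ▸ hi)
    rwa [ht] at this
  refine ⟨⟨t, ht ▸ hs, ht ▸ linearIndepOn_coroot_of_root P hs, ht ▸ hsp, ?_⟩, ?_⟩
  · rw [ht]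
    intro i
    rcases hsp i with h | h
    · exact .inl (hco i h)
    · right
      have := hco (-i) (by simpa using h)
      simpa using this
  · intro i hi
    exact (hy i).2 (hpos i ((hmem i).mp hi))

end BaseExists

/-! ### Weyl orbits, components, lengths and supports of roots. -/

section RootCombinatorics

variable {ι X Y : Type*} [AddCommGroup X] [AddCommGroup Y]

/-! ### Permutations of the roots -/

/-- The group of permutations of the roots generated by the reflections. -/
def reflectionGroup (P : RootDatum ι X Y) : Subgroup (ι ≃ ι) :=
  Subgroup.closure (Set.range P.reflectionPerm)

lemma reflectionPerm_mem_reflectionGroup (P : RootDatum ι X Y) (k : ι) :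
    P.reflectionPerm k ∈ reflectionGroup P :=
  Subgroup.subset_closure (Set.mem_range_self k)

/-- Quasi-constancy only sees the permutation induced by a Weyl group element, and the group of
these permutations admits induction over reflections. -/
lemma forall_weylGroup_iff (P : RootDatum ι X Y) (p : (ι ≃ ι) → Prop) :
    (∀ w : P.weylGroup, p (P.weylGroupToPerm w)) ↔ ∀ g ∈ reflectionGroup P, p g := by
  rw [reflectionGroup, ← P.range_weylGroupToPerm]
  constructor
  · rintro h - ⟨w, rfl⟩
    exact h w
  · exact fun h w ↦ h _ ⟨w, rfl⟩

/-- A permutation of the roots that preserves all Cartan integers. -/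
def IsPairingPreserving (P : RootDatum ι X Y) (e : ι ≃ ι) : Prop :=
  ∀ i j, P.pairing (e i) (e j) = P.pairing i j

lemma isPairingPreserving_reflectionPerm (P : RootDatum ι X Y) (k : ι) :
    IsPairingPreserving P (P.reflectionPerm k) := fun i j ↦ by
  rw [← P.pairing_reflectionPerm, P.reflectionPerm_self]

lemma isPairingPreserving_of_mem {P : RootDatum ι X Y} {g : ι ≃ ι}
    (hg : g ∈ reflectionGroup P) : IsPairingPreserving P g := by
  induction hg using Subgroup.closure_induction with
  | mem g hg =>
    obtain ⟨k, rfl⟩ := hg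
    exact isPairingPreserving_reflectionPerm P k
  | one => exact fun i j ↦ rfl
  | mul g h _ _ hg hh => exact fun i j ↦ (hg _ _).trans (hh i j)
  | inv g _ hg => exact fun i j ↦ by simpa using (hg (g⁻¹ i) (g⁻¹ j)).symm

lemma isPairingPreserving_galPerm {Γ : Type*} [Group Γ] (P : RootDatum ι X Y) (ρ : Γ →* P.Aut)
    (σ : Γ) : IsPairingPreserving P (galPerm P ρ σ) := fun i j ↦ by
  let g : P.Aut := ρ σ
  have hr : P.root (galPerm P ρ σ i) = g.toHom.weightMap (P.root i) :=
    (g.toHom.root_weightMap_apply P P i).symm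
  -- The coweight map is contravariant, so it undoes the permutation on coroots.
  have hc : g.toHom.coweightMap (P.coroot (galPerm P ρ σ j)) = P.coroot j := by
    refine (g.toHom.coroot_coweightMap_apply P P (galPerm P ρ σ j)).trans ?_
    congr 1
    exact g.indexEquiv.symm_apply_apply j
  rw [← P.root_coroot_eq_pairing, ← P.root_coroot_eq_pairing, hr, ← hc]
  exact (congrFun (congrArg DFunLike.coe
    (congrFun (congrArg DFunLike.coe g.toHom.weight_coweight_transpose) _)) _)

/-! ### Components -/

lemma mem_component_self (P : RootDatum ι X Y) (c : ι) : c ∈ component P c := .refl c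

lemma mem_component_of_pairing {P : RootDatum ι X Y} {i j : ι} (h : P.pairing i j ≠ 0) :
    j ∈ component P i := .rel _ _ h

lemma mem_component_symm {P : RootDatum ι X Y} {i j : ι} (h : j ∈ component P i) :
    i ∈ component P j := .symm _ _ h

lemma mem_component_trans {P : RootDatum ι X Y} {i j k : ι} (h : j ∈ component P i)
    (h' : k ∈ component P j) : k ∈ component P i := .trans _ _ _ h h'

lemma map_mem_component {P : RootDatum ι X Y} {e : ι ≃ ι} (he : IsPairingPreserving P e)
    {i j : ι} (h : j ∈ component P i) : e j ∈ component P (e i) := by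
  induction h with
  | rel i j h => exact .rel _ _ (by rwa [he])
  | refl i => exact .refl _
  | symm i j _ h => exact .symm _ _ h
  | trans i j k _ _ h h' => exact .trans _ _ _ h h'

lemma isTorsionFree_weight (P : RootDatum ι X Y) : Module.IsTorsionFree ℤ X := by
  have : Module.IsReflexive ℤ X := .of_isPerfPair P.toLinearMap
  infer_instance

lemma pairing_eq_zero_comm (P : RootDatum ι X Y) {i j : ι} :
    P.pairing i j = 0 ↔ P.pairing j i = 0 :=
  have := isTorsionFree_weight P
  P.pairing_eq_zero_iff

/-- A reflection in `k` either fixes `i`, when the two are orthogonal, or takes it to a root that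
again pairs nontrivially with `k`. -/
lemma mem_component_of_mem_reflectionGroup {P : RootDatum ι X Y} {g : ι ≃ ι}
    (hg : g ∈ reflectionGroup P) (i : ι) : g i ∈ component P i := by
  induction hg using Subgroup.closure_induction generalizing i with
  | mem g hg =>
    obtain ⟨k, rfl⟩ := hg
    by_cases h : P.pairing i k = 0
    · rw [P.reflectionPerm_eq_of_pairing_eq_zero h]
      exact mem_component_self P i
    · refine mem_component_trans (mem_component_of_pairing h)
        (mem_component_symm (mem_component_of_pairing ?_))
      rwa [← P.pairing_reflectionPerm, P.pairing_reflectionPerm_self_right, neg_ne_zero]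
  | one => exact mem_component_self P i
  | mul g h _ _ hg hh => exact mem_component_trans (hh i) (hg _)
  | inv g _ hg => simpa using mem_component_symm (hg (g⁻¹ i))

/-! ### Lengths -/

variable [Finite ι]

/-- The squared length of a root for the canonical invariant form. -/
def rootLen (P : RootDatum ι X Y) (i : ι) : ℤ :=
  letI := Fintype.ofFinite ι
  P.RootForm (P.root i) (P.root i)

lemma rootLen_pos (P : RootDatum ι X Y) (i : ι) : 0 < rootLen P i :=
  let := Fintype.ofFinite ι
  P.rootForm_pos_of_ne_zero (Submodule.subset_span (Set.mem_range_self i)) (P.ne_zero i)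

/-- The squared length is a sum over all roots of squared Cartan integers, which `e` merely
permutes. -/
lemma rootLen_map {P : RootDatum ι X Y} {e : ι ≃ ι} (he : IsPairingPreserving P e) (i : ι) :
    rootLen P (e i) = rootLen P i := by
  let := Fintype.ofFinite ι
  rw [rootLen, rootLen, P.rootForm_root_self, P.rootForm_root_self]
  exact (Fintype.sum_equiv e _ _ fun j ↦ by rw [he]).symm

/-- The left side is twice the polarization of the root, which is linear in the root. -/
lemma rootLen_smul_coroot {P : RootDatum ι X Y} {s : Finset ι} {i : ι} {n : ι → ℤ}
    (h : P.root i = ∑ j ∈ s, n j • P.root j) :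
    rootLen P i • P.coroot i = ∑ j ∈ s, (n j * rootLen P j) • P.coroot j := by
  let := Fintype.ofFinite ι
  have h1 (k : ι) : rootLen P k • P.coroot k = 2 • P.Polarization (P.root k) :=
    P.rootForm_self_smul_coroot k
  rw [h1, h, map_sum, Finset.smul_sum]
  refine Finset.sum_congr rfl fun k _ ↦ ?_
  rw [map_smul, smul_comm, ← h1, smul_smul]

/-! ### Expansions in simple roots -/

/-- In the expansion of a root in simple roots, only those in its component occur. -/
lemma mem_component_of_coeff_ne_zero {P : RootDatum ι X Y} (b : P.Base) {i : ι} {n : ι → ℤ}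
    (h : P.root i = ∑ j ∈ b.support, n j • P.root j) {j : ι} (hj : j ∈ b.support)
    (hn : n j ≠ 0) : j ∈ component P i := by
  classical
  by_contra hji
  have hmem (s : Finset ι) : ∑ j ∈ s, n j • P.root j ∈ P.rootSpan ℤ :=
    sum_mem fun j _ ↦ Submodule.smul_mem _ _ (Submodule.subset_span (Set.mem_range_self j))
  let t := b.support.filter (· ∉ component P i)
  -- The part of the expansion outside the component is orthogonal to every simple coroot: termwise
  -- if `k` is in the component, and otherwise because the root `i` and the remaining terms are.
  have hz := eq_zero_of_coroot_eq_zero P b ⟨_, hmem t⟩ fun k hk ↦ by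
    change P.coroot' k (∑ j ∈ t, n j • P.root j) = 0
    by_cases hki : k ∈ component P i
    · rw [map_sum]
      refine Finset.sum_eq_zero fun j hj ↦ ?_
      obtain ⟨-, hj⟩ := Finset.mem_filter.mp hj
      have : P.pairing j k = 0 := by
        by_contra h
        exact hj (mem_component_trans hki (mem_component_symm (mem_component_of_pairing h)))
      simp [this]
    · have h1 : P.coroot' k (P.root i) = 0 := by
        by_contra h
        exact hki (mem_component_of_pairing h)
      rw [h, ← Finset.sum_filter_add_sum_filter_not _ (· ∉ component P i), map_add] at h1
      rw [← h1, left_eq_add, map_sum]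
      refine Finset.sum_eq_zero fun j hj ↦ ?_
      obtain ⟨-, hj⟩ := Finset.mem_filter.mp hj
      have : P.pairing j k = 0 := by
        by_contra h
        exact hki (mem_component_trans (not_not.mp hj) (mem_component_of_pairing h))
      simp [this]
  have hz' : ∑ j ∈ t, n j • P.root j = 0 := congrArg Subtype.val hz
  exact hn (linearIndepOn_iff'.mp b.linearIndepOn_root t n
    (fun j hj ↦ (Finset.mem_filter.mp hj).1) hz' j (Finset.mem_filter.mpr ⟨hj, hji⟩))

/-- If a set of simple roots is orthogonal to the other simple roots, then it is stable under
passage to the component. -/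
lemma mem_of_mem_component {P : RootDatum ι X Y} [P.IsReduced] (b : P.Base) (s : Set ι)
    (hs : ∀ j ∈ b.support, j ∈ s → ∀ k ∈ b.support, k ∉ s → P.pairing j k = 0) {i k : ι}
    (hi : P.root i ∈ Submodule.span ℤ (P.root '' (b.support ∩ s))) (hk : k ∈ b.support)
    (hki : k ∈ component P i) : k ∈ s := by
  let U := Submodule.span ℤ (P.root '' (b.support ∩ s))
  let U' := Submodule.span ℤ (P.root '' (b.support ∩ sᶜ))
  have hU {j : ι} (hj : j ∈ b.support) (hjs : j ∉ s) {x : X} (hx : x ∈ U) :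
      P.coroot' j x = 0 := by
    have : U ≤ LinearMap.ker (P.coroot' j) := by
      rw [Submodule.span_le]
      rintro - ⟨l, ⟨hl, hls⟩, rfl⟩
      exact hs l hl hls j hj hjs
    exact this hx
  have hU' {j : ι} (hj : j ∈ b.support) (hjs : j ∈ s) {x : X} (hx : x ∈ U') :
      P.coroot' j x = 0 := by
    have : U' ≤ LinearMap.ker (P.coroot' j) := by
      rw [Submodule.span_le]
      rintro - ⟨l, ⟨hl, hls⟩, rfl⟩
      exact (pairing_eq_zero_comm P).mp (hs j hj hjs l hl hls)
    exact this hx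
  -- Each simple reflection preserves both `U` and `U'`, so every root lies in one of them.
  have hdich (l : ι) : P.root l ∈ U ∨ P.root l ∈ U' := by
    induction l using b.induction_reflect with
    | h₀ i hi =>
      rw [P.root_reflectionPerm, P.reflection_apply_self, neg_mem_iff, neg_mem_iff]
      exact hi
    | h₁ i hi =>
      by_cases his : i ∈ s
      · exact .inl (Submodule.subset_span ⟨i, ⟨hi, his⟩, rfl⟩)
      · exact .inr (Submodule.subset_span ⟨i, ⟨hi, his⟩, rfl⟩)
    | h₂ i j hi hj =>
      rw [P.root_reflectionPerm, P.reflection_apply]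
      by_cases hjs : j ∈ s
      · refine hi.imp (fun h ↦ sub_mem h (Submodule.smul_mem _ _ ?_)) fun h ↦ ?_
        · exact Submodule.subset_span ⟨j, ⟨hj, hjs⟩, rfl⟩
        · rwa [hU' hj hjs h, zero_smul, sub_zero]
      · refine hi.imp (fun h ↦ ?_) fun h ↦ sub_mem h (Submodule.smul_mem _ _ ?_)
        · rwa [hU hj hjs h, zero_smul, sub_zero]
        · exact Submodule.subset_span ⟨j, ⟨hj, hjs⟩, rfl⟩
  have horth {l m : ι} (hl : P.root l ∈ U) (hm : P.root m ∈ U') : P.pairing l m = 0 := by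
    have : U ≤ LinearMap.ker (P.coroot' m) := by
      rw [Submodule.span_le]
      rintro - ⟨j, ⟨hj, hjs⟩, rfl⟩
      exact (pairing_eq_zero_comm P).mp (hU' hj hjs hm)
    exact this hl
  have hdisj {l : ι} (hl : P.root l ∈ U) (hl' : P.root l ∈ U') : False := by
    have := horth hl hl'
    rw [P.pairing_same] at this
    lia
  have hclass {l m : ι} (h : m ∈ component P l) : P.root l ∈ U ↔ P.root m ∈ U := by
    induction h with
    | rel l m h =>
      constructor
      · exact fun hl ↦ (hdich m).resolve_right fun hm ↦ h (horth hl hm)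
      · exact fun hm ↦ (hdich l).resolve_right fun hl ↦
          h ((pairing_eq_zero_comm P).mp (horth hm hl))
    | refl l => rfl
    | symm l m _ h => exact h.symm
    | trans l m n _ _ h h' => exact h.trans h'
  by_contra hks
  exact hdisj ((hclass hki).mp hi) (Submodule.subset_span ⟨k, ⟨hk, hks⟩, rfl⟩)

/-- Every root is conjugate under the Weyl group to a positive root in which all simple roots of its
component occur. -/
theorem exists_mem_orbit_full_support (P : RootDatum ι X Y) [P.IsReduced] (b : P.Base) (i : ι) :
    ∃ g ∈ reflectionGroup P, ∃ n : ι → ℤ, P.root (g i) = ∑ j ∈ b.support, n j • P.root j ∧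
      (∀ j, 0 ≤ n j) ∧ ∀ j ∈ b.support, j ∈ component P i → 1 ≤ n j := by
  -- A root of maximal height in the orbit is dominant, since simple reflections cannot raise the
  -- height, and positive, since its own reflection negates it.
  obtain ⟨l, ⟨g, hg, rfl⟩, hmax⟩ := Set.exists_max_image {l | ∃ g ∈ reflectionGroup P, g i = l}
    b.height (Set.toFinite _) ⟨i, 1, one_mem _, rfl⟩
  have hmax' (k : ι) : b.height (P.reflectionPerm k (g i)) ≤ b.height (g i) :=
    hmax _ ⟨P.reflectionPerm k * g, mul_mem (reflectionPerm_mem_reflectionGroup P k) hg, rfl⟩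
  have hdom (k : ι) (hk : k ∈ b.support) : 0 ≤ P.pairing (g i) k := by
    have h1 : P.root (P.reflectionPerm k (g i)) =
        P.root (g i) + (-P.pairing (g i) k) • P.root k := by
      rw [neg_smul, ← sub_eq_add_neg]
      exact P.root_reflectionPerm k (g i)
    have h2 := hmax' k
    rw [b.height_add_zsmul h1, RootPairing.Base.height_one_of_mem_support hk, smul_eq_mul] at h2
    lia
  have hpos : 0 < b.height (g i) := by
    have h1 := b.height_reflectionPerm_self (g i)
    have h2 := hmax' (g i)
    have h3 := b.height_ne_zero (g i)
    change b.height (P.reflectionPerm (g i) (g i)) = _ at h1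
    lia
  obtain ⟨n, -, hn, hgn⟩ := b.exists_root_eq_sum_int (g i)
  have hn0 : ∀ j, 0 ≤ n j := by
    rcases hn with hn | hn
    · exact hn.le
    · rw [RootPairing.Base.height_eq_sum hgn] at hpos
      exact absurd hpos (not_lt.mpr (Finset.sum_nonpos fun j _ ↦ hn.le j))
  refine ⟨g, hg, n, hgn, hn0, fun j hj hji ↦ ?_⟩
  suffices j ∈ {k | 0 < n k} from this
  -- For simple `k` outside the support, the pairing of the root with the coroot of `k` is
  -- nonnegative by dominance but a sum of nonpositive terms, so every term vanishes: the support is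
  -- orthogonal to the other simple roots.
  refine mem_of_mem_component b {k | 0 < n k} (fun j hj hjs k hk hks ↦ ?_) (i := g i) ?_ hj
    (mem_component_trans (mem_component_symm (mem_component_of_mem_reflectionGroup hg i)) hji)
  · have hle (l : ι) (hl : l ∈ b.support) : n l * P.pairing l k ≤ 0 := by
      by_cases hlk : l = k
      · subst hlk
        have h0 : n l = 0 := le_antisymm (not_lt.mp hks) (hn0 l)
        simp [h0]
      · have := b.pairingIn_le_zero_of_ne hlk hl hk
        have h2 := P.algebraMap_pairingIn ℤ l k
        simp only [Algebra.algebraMap_self, RingHom.id_apply] at h2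
        rw [h2] at this
        exact mul_nonpos_of_nonneg_of_nonpos (hn0 l) this
    have hsum : ∑ l ∈ b.support, n l * P.pairing l k = 0 := by
      refine le_antisymm (Finset.sum_nonpos hle) ?_
      have := hdom k hk
      rw [← P.root_coroot_eq_pairing, hgn] at this
      simpa using this
    have := (Finset.sum_eq_zero_iff_of_nonpos hle).mp hsum j hj
    exact (mul_eq_zero.mp this).resolve_left (ne_of_gt hjs)
  · rw [hgn]
    refine sum_mem fun l hl ↦ ?_
    rcases (hn0 l).eq_or_lt with h | h
    · rw [← h, zero_smul]
      exact zero_mem _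
    · exact Submodule.smul_mem _ _ (Submodule.subset_span ⟨l, ⟨hl, h⟩, rfl⟩)

end RootCombinatorics

/-! ### Quasi-constancy in terms of values, and dominant quasi-constant cocharacters. -/

section QuasiConstantFunctions

variable {ι X Y Γ : Type*} [AddCommGroup X] [AddCommGroup Y] [Group Γ]

/-- A function on the roots whose nonzero values on each orbit of `W ⋊ Γ` agree up to sign. -/
def IsQuasiConstantFun (P : RootDatum ι X Y) (π : Γ →* (ι ≃ ι)) (f : ι → ℚ) : Prop :=
  ∀ i, f i ≠ 0 → ∀ g ∈ reflectionGroup P, ∀ σ : Γ,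
    f (g (π σ i)) = 0 ∨ f (g (π σ i)) = f i ∨ f (g (π σ i)) = -f i

lemma div_mem_iff {a b : ℚ} (hb : b ≠ 0) :
    a / b ∈ ({-1, 0, 1} : Set ℚ) ↔ a = 0 ∨ a = b ∨ a = -b := by
  simp only [Set.mem_insert_iff, Set.mem_singleton_iff, div_eq_iff hb, neg_mul, one_mul, zero_mul]
  tauto

/-- The ratios are invariant under scaling, and some positive multiple of `v` is a lattice point.
The family `φ` will be the roots or the coroots. -/
lemma forall_mem_span₀_iff {A : Type*} [AddCommGroup A] (P : RootDatum ι X Y) (π : Γ →* (ι ≃ ι))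
    (φ : ι → A →ₗ[ℤ] ℤ) (v : ℚ ⊗[ℤ] A) :
    (∀ a : A, (1 : ℚ) ⊗ₜ[ℤ] a ∈ span₀ v → ∀ i, φ i a ≠ 0 → ∀ (w : P.weylGroup) (σ : Γ),
      (φ (P.weylGroupToPerm w (π σ i)) a : ℚ) / (φ i a : ℚ) ∈ ({-1, 0, 1} : Set ℚ)) ↔
    IsQuasiConstantFun P π fun i ↦ ratExt (φ i) v := by
  have hW (a : A) (i : ι) : (∀ (w : P.weylGroup) (σ : Γ),
      (φ (P.weylGroupToPerm w (π σ i)) a : ℚ) / (φ i a : ℚ) ∈ ({-1, 0, 1} : Set ℚ)) ↔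
      ∀ g ∈ reflectionGroup P, ∀ σ : Γ,
        (φ (g (π σ i)) a : ℚ) / (φ i a : ℚ) ∈ ({-1, 0, 1} : Set ℚ) :=
    forall_weylGroup_iff P fun g ↦ ∀ σ : Γ,
      (φ (g (π σ i)) a : ℚ) / (φ i a : ℚ) ∈ ({-1, 0, 1} : Set ℚ)
  simp only [hW]
  have hval {q : ℚ} {a : A} (h : (1 : ℚ) ⊗ₜ[ℤ] a = q • v) (i : ι) :
      (φ i a : ℚ) = q * ratExt (φ i) v := by
    have := congrArg (ratExt (φ i)) h
    simpa using this
  constructor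
  · intro h i hi g hg σ
    obtain ⟨n, hn, a, ha⟩ := exists_pos_smul_eq_one_tmul v
    have hn' : (0 : ℚ) < n := by exact_mod_cast hn
    have hai : (φ i a : ℚ) ≠ 0 := by
      rw [hval ha.symm]
      exact mul_ne_zero hn'.ne' hi
    have := h a ⟨n, hn'.le, ha.symm⟩ i (by exact_mod_cast hai) g hg σ
    rw [hval ha.symm, hval ha.symm, mul_div_mul_left _ _ hn'.ne', div_mem_iff hi] at this
    exact this
  · rintro h a ⟨q, -, hq⟩ i hi g hg σ
    have hi' : (φ i a : ℚ) ≠ 0 := by exact_mod_cast hi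
    rw [hval hq] at hi'
    rw [hval hq, hval hq, mul_div_mul_left _ _ (left_ne_zero_of_mul hi'),
      div_mem_iff (right_ne_zero_of_mul hi')]
    exact h i (right_ne_zero_of_mul hi') g hg σ

lemma isQuasiConstantCharRay_iff (P : RootDatum ι X Y) (π : Γ →* (ι ≃ ι)) (r : Set (ℚ ⊗[ℤ] X)) :
    IsQuasiConstantCharRay P π r ↔
      ∃ v, v ≠ 0 ∧ r = span₀ v ∧ IsQuasiConstantFun P π fun i ↦ corootVal P i v := by
  constructor
  · rintro ⟨⟨v, hv, rfl⟩, h⟩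
    exact ⟨v, hv, rfl, (forall_mem_span₀_iff P π (fun i ↦ P.coroot' i) v).mp h⟩
  · rintro ⟨v, hv, rfl, h⟩
    exact ⟨⟨v, hv, rfl⟩, (forall_mem_span₀_iff P π (fun i ↦ P.coroot' i) v).mpr h⟩

lemma isQuasiConstantCocharRay_iff (P : RootDatum ι X Y) (π : Γ →* (ι ≃ ι))
    (r : Set (ℚ ⊗[ℤ] Y)) :
    IsQuasiConstantCocharRay P π r ↔
      ∃ v, v ≠ 0 ∧ r = span₀ v ∧ IsQuasiConstantFun P π fun i ↦ rootVal P i v := by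
  constructor
  · rintro ⟨⟨v, hv, rfl⟩, h⟩
    exact ⟨v, hv, rfl, (forall_mem_span₀_iff P π (fun i ↦ P.root' i) v).mp h⟩
  · rintro ⟨v, hv, rfl, h⟩
    exact ⟨⟨v, hv, rfl⟩, (forall_mem_span₀_iff P π (fun i ↦ P.root' i) v).mpr h⟩

/-- The Weyl groups of `P` and `P.flip` are different types, but their reflections permute the
indices identically, so the criteria by values coincide. -/
lemma isQuasiConstantCharRay_flip (P : RootDatum ι X Y) (π : Γ →* (ι ≃ ι))
    (r : Set (ℚ ⊗[ℤ] Y)) :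
    IsQuasiConstantCharRay P.flip π r ↔ IsQuasiConstantCocharRay P π r := by
  rw [isQuasiConstantCharRay_iff, isQuasiConstantCocharRay_iff]
  rfl

lemma isQuasiConstantCocharRay_flip (P : RootDatum ι X Y) (π : Γ →* (ι ≃ ι))
    (r : Set (ℚ ⊗[ℤ] X)) :
    IsQuasiConstantCocharRay P.flip π r ↔ IsQuasiConstantCharRay P π r :=
  (isQuasiConstantCharRay_flip P.flip π r).symm

/-! ### Values on roots and coroots -/

lemma rootVal_eq_sum {P : RootDatum ι X Y} {s : Finset ι} {i : ι} {n : ι → ℤ}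
    (h : P.root i = ∑ j ∈ s, n j • P.root j) (v : ℚ ⊗[ℤ] Y) :
    rootVal P i v = ∑ j ∈ s, n j * rootVal P j v := by
  have : P.root' i = ∑ j ∈ s, n j • P.root' j := by simp [RootPairing.root', h]
  simp [rootVal, this, ratExt_sum, ratExt_zsmul]

variable [Finite ι]

lemma rootLen_mul_corootVal {P : RootDatum ι X Y} {s : Finset ι} {i : ι} {n : ι → ℤ}
    (h : P.root i = ∑ j ∈ s, n j • P.root j) (x : ℚ ⊗[ℤ] X) :
    rootLen P i * corootVal P i x = ∑ j ∈ s, n j * rootLen P j * corootVal P j x := by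
  have : rootLen P i • P.coroot' i = ∑ j ∈ s, (n j * rootLen P j) • P.coroot' j := by
    rw [RootPairing.coroot', ← map_smul, rootLen_smul_coroot h, map_sum]
    exact Finset.sum_congr rfl fun j _ ↦ map_smul ..
  have := congrArg (fun φ ↦ ratExt φ x) this
  simpa [corootVal, ratExt_sum, ratExt_zsmul] using this

/-- The quotient is the coefficient of `k` in the expansion of the coroot of `i` in simple coroots,
which is an integer. -/
lemma rootLen_dvd {P : RootDatum ι X Y} (b : P.Base) {i : ι} {n : ι → ℤ}
    (h : P.root i = ∑ j ∈ b.support, n j • P.root j) {k : ι} (hk : k ∈ b.support) :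
    rootLen P i ∣ n k * rootLen P k := by
  obtain ⟨m, -, -, hm⟩ := b.flip.exists_root_eq_sum_int i
  replace hm : P.coroot i = ∑ j ∈ b.support, m j • P.coroot j := hm
  have h1 := rootLen_smul_coroot h
  rw [hm, Finset.smul_sum, ← sub_eq_zero, ← Finset.sum_sub_distrib] at h1
  simp only [smul_smul, ← sub_smul] at h1
  have h2 := linearIndepOn_iff'.mp b.linearIndepOn_coroot b.support _ subset_rfl h1 k hk
  exact ⟨m k, by lia⟩

/-! ### Dominant quasi-constant cocharacters -/

section Dominant

variable {P : RootDatum ι X Y} [P.IsReduced] {π : Γ →* (ι ≃ ι)}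
  (hπ : ∀ σ, IsPairingPreserving P (π σ)) {v : ℚ ⊗[ℤ] Y}
  (hv : IsQuasiConstantFun P π fun i ↦ rootVal P i v)

include hπ hv

/-- The conjugate `l` of `π σ i` with full support has positive value, because `k` occurs in it; of
the values 0, `±rootVal P i v` allowed by quasi-constancy only the positive one remains. -/
lemma exists_conjugate_of_dominant (b : P.Base) (hb : ∀ i ∈ b.support, 0 ≤ rootVal P i v)
    {i k : ι} {σ : Γ} (hi : 0 < rootVal P i v) (hk : k ∈ b.support)
    (hki : k ∈ component P (π σ i)) (hk0 : 0 < rootVal P k v) :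
    ∃ (l : ι) (n : ι → ℤ), rootLen P l = rootLen P i ∧
      P.root l = ∑ j ∈ b.support, n j • P.root j ∧ (∀ j, 0 ≤ n j) ∧
      (∀ j ∈ b.support, j ∈ component P (π σ i) → 1 ≤ n j) ∧
      rootVal P i v = ∑ j ∈ b.support, n j * rootVal P j v := by
  obtain ⟨g, hg, n, hgn, hn0, hn1⟩ := exists_mem_orbit_full_support P b (π σ i)
  refine ⟨g (π σ i), n, ?_, hgn, hn0, hn1, ?_⟩
  · rw [rootLen_map (isPairingPreserving_of_mem hg), rootLen_map (hπ σ)]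
  · have hsum := rootVal_eq_sum hgn v
    have hpos : 0 < rootVal P (g (π σ i)) v := by
      rw [hsum]
      refine Finset.sum_pos' (fun j hj ↦ mul_nonneg (by exact_mod_cast hn0 j) (hb j hj))
        ⟨k, hk, mul_pos ?_ hk0⟩
      have := hn1 k hk hki
      exact_mod_cast (by lia : 0 < n k)
    rw [← hsum]
    rcases hv i hi.ne' g hg σ with h | h | h
    · exact absurd h hpos.ne'
    · exact h.symm
    · have : rootVal P (g (π σ i)) v = -rootVal P i v := h
      linarith

/-- Otherwise the value at `i` would be at least the sum of the values at `i` and `k`. -/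
lemma eq_of_mem_component (b : P.Base) (hb : ∀ i ∈ b.support, 0 ≤ rootVal P i v) {i k : ι}
    (hi : i ∈ b.support) (hk : k ∈ b.support) (hki : k ∈ component P i)
    (hi0 : 0 < rootVal P i v) (hk0 : 0 < rootVal P k v) : i = k := by
  by_contra hne
  have h1 : π 1 i = i := by simp
  obtain ⟨l, n, -, -, hn0, hn1, hval⟩ := exists_conjugate_of_dominant hπ hv b hb (σ := 1) hi0 hk
    (h1.symm ▸ hki) hk0
  rw [h1] at hn1
  have hterm (j : ι) (hj : j ∈ b.support) (hji : j ∈ component P i) :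
      rootVal P j v ≤ n j * rootVal P j v :=
    le_mul_of_one_le_left (hb j hj) (by exact_mod_cast hn1 j hj hji)
  have h2 := Finset.add_le_sum (f := fun j ↦ n j * rootVal P j v)
    (fun j hj ↦ mul_nonneg (by exact_mod_cast hn0 j) (hb j hj)) hi hk hne
  have h3 := hterm i hi (mem_component_self P i)
  have h4 := hterm k hk hki
  linarith

/-- The value at `i` is at least the single term `n k * rootVal P k v`. Equality of values forces `n
k = 1`, and then the length of `i` divides that of `k`. -/
lemma rootVal_le_and_rootLen_le (b : P.Base) (hb : ∀ i ∈ b.support, 0 ≤ rootVal P i v) {i k : ι}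
    {σ : Γ} (hi : 0 < rootVal P i v) (hk : k ∈ b.support) (hki : k ∈ component P (π σ i))
    (hk0 : 0 < rootVal P k v) :
    rootVal P k v ≤ rootVal P i v ∧
      (rootVal P i v ≤ rootVal P k v → rootLen P i ≤ rootLen P k) := by
  obtain ⟨l, n, hlen, hln, hn0, hn1, hval⟩ :=
    exists_conjugate_of_dominant hπ hv b hb hi hk hki hk0
  have h1 := Finset.single_le_sum (f := fun j ↦ n j * rootVal P j v)
    (fun j hj ↦ mul_nonneg (by exact_mod_cast hn0 j) (hb j hj)) hk
  rw [← hval] at h1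
  have hnk := hn1 k hk hki
  constructor
  · refine le_trans ?_ h1
    exact le_mul_of_one_le_left hk0.le (by exact_mod_cast hnk)
  · intro hle
    have h2 : (n k : ℚ) ≤ 1 := by
      refine le_of_mul_le_mul_right ?_ hk0
      rw [one_mul]
      exact h1.trans hle
    have h3 : n k = 1 := le_antisymm (by exact_mod_cast h2) hnk
    have h4 := rootLen_dvd b hln hk
    rw [h3, one_mul, hlen] at h4
    exact Int.le_of_dvd (rootLen_pos P k) h4

/-- The values and the lengths of the simple roots that are not orthogonal to a quasi-constant
cocharacter are constant on `Γ`-orbits of components, also for different dominant bases. -/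
theorem rootVal_eq_and_rootLen_eq {b b' : P.Base} (hb : ∀ i ∈ b.support, 0 ≤ rootVal P i v)
    (hb' : ∀ i ∈ b'.support, 0 ≤ rootVal P i v) {i k : ι} {σ : Γ} (hi : i ∈ b.support)
    (hk : k ∈ b'.support) (hki : k ∈ component P (π σ i)) (hi0 : 0 < rootVal P i v)
    (hk0 : 0 < rootVal P k v) :
    rootVal P i v = rootVal P k v ∧ rootLen P i = rootLen P k := by
  -- The previous comparison only needs a base containing the second root, so with `σ⁻¹` and the
  -- other base it applies in the reverse direction.
  have hik : i ∈ component P (π σ⁻¹ k) := by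
    have := map_mem_component (hπ σ⁻¹) (mem_component_symm hki)
    rwa [← Equiv.Perm.mul_apply, ← map_mul, inv_mul_cancel, map_one, Equiv.Perm.one_apply] at this
  obtain ⟨h1, h2⟩ := rootVal_le_and_rootLen_le hπ hv b' hb' hi0 hk hki hk0
  obtain ⟨h3, h4⟩ := rootVal_le_and_rootLen_le hπ hv b hb hk0 hi hik hi0
  exact ⟨le_antisymm h3 h1, le_antisymm (h2 h3) (h4 h1)⟩

end Dominant

end QuasiConstantFunctions

/-! ### The dual vector and its values on all coroots. -/

section DualVector

variable {ι X Y Γ : Type*} [AddCommGroup X] [AddCommGroup Y] [Group Γ] [Finite ι]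
  [Module.Finite ℤ X]

lemma corootVal_adjoint (P : RootDatum ι X Y) (i : ι) (x : ℚ ⊗[ℤ] P.rootSpan ℤ) :
    corootVal (adjoint P) i x = corootVal P i (prPull P x) :=
  (ratExt_baseChange (P.coroot' i) (P.rootSpan ℤ).subtype x).symm

lemma rootVal_adjoint (P : RootDatum ι X Y) (i : ι) (v : ℚ ⊗[ℤ] Y) :
    rootVal (adjoint P) i (prPush P v) = rootVal P i v :=
  ratExt_baseChange ((adjoint P).root' i) _ v

lemma eq_of_corootVal_adjoint_eq {P : RootDatum ι X Y} (b : P.Base)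
    {x y : ℚ ⊗[ℤ] P.rootSpan ℤ}
    (h : ∀ i ∈ b.support, corootVal (adjoint P) i x = corootVal (adjoint P) i y) : x = y :=
  (existsUnique_fundWeight P b fun j ↦ corootVal (adjoint P) j y).unique (fun j ↦ h j j.2)
    fun _ ↦ rfl

/-- The vector of `X^*(T^ad)_ℚ` whose value on a simple coroot `α_i^∨` is `φ ⟨α_i, v⟩`. -/
def dualVec (P : RootDatum ι X Y) (b : P.Base) (φ : ℚ → ℚ) (v : ℚ ⊗[ℤ] Y) :
    ℚ ⊗[ℤ] P.rootSpan ℤ :=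
  ∑ i : b.support, φ (rootVal P i v) • fundWeight P b i

lemma corootVal_dualVec (P : RootDatum ι X Y) (b : P.Base) (φ : ℚ → ℚ) (v : ℚ ⊗[ℤ] Y) {j : ι}
    (hj : j ∈ b.support) : corootVal P j (prPull P (dualVec P b φ v)) = φ (rootVal P j v) := by
  rw [← corootVal_adjoint, dualVec, map_sum, Finset.sum_eq_single ⟨j, hj⟩]
  · rw [map_smul, corootVal_fundWeight P b ⟨j, hj⟩ ⟨j, hj⟩]
    simp
  · intro i _ hi
    rw [map_smul, corootVal_fundWeight P b i ⟨j, hj⟩]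
    simp [hi.symm]
  · simp

/-- The indicator function of the nonzero rational numbers. -/
def nonzeroIndicator (q : ℚ) : ℚ := if q = 0 then 0 else 1

lemma nonzeroIndicator_zero : nonzeroIndicator 0 = 0 := if_pos rfl

lemma nonzeroIndicator_of_ne {q : ℚ} (hq : q ≠ 0) : nonzeroIndicator q = 1 := if_neg hq

lemma dualRayAd_span₀ (P : RootDatum ι X Y) (b : P.Base) (v : ℚ ⊗[ℤ] Y) :
    dualRayAd P b (span₀ v) = span₀ (dualVec P b id v) := by
  refine (image_span₀ (coweightToWeight P b ∘ₗ prPush P) v).trans ?_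
  congr 1
  simp [coweightToWeight, dualVec, rootVal_adjoint]

lemma unitDualRayAd_span₀ (P : RootDatum ι X Y) (b : P.Base) (v : ℚ ⊗[ℤ] Y) :
    unitDualRayAd P b (span₀ v) = span₀ (dualVec P b nonzeroIndicator v) := by
  classical
  rw [unitDualRayAd, dualVec]
  congr 1
  refine Finset.sum_congr rfl fun i _ ↦ ?_
  have : (∃ μ ∈ span₀ v, rootVal P i μ ≠ 0) ↔ rootVal P i v ≠ 0 := by
    refine ⟨?_, fun h ↦ ⟨v, self_mem_span₀ v, h⟩⟩
    rintro ⟨-, ⟨q, -, rfl⟩, h⟩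
    rw [map_smul] at h
    exact right_ne_zero_of_smul h
  simp [this, nonzeroIndicator, ite_not]

variable {P : RootDatum ι X Y} [P.IsReduced] {π : Γ →* (ι ≃ ι)}
  (hπ : ∀ σ, IsPairingPreserving P (π σ)) {v : ℚ ⊗[ℤ] Y}
  (hv : IsQuasiConstantFun P π fun i ↦ rootVal P i v)
  {φ : ℚ → ℚ} (hφ0 : φ 0 = 0) (hφ : ∀ q, 0 < q → 0 < φ q)

include hπ hv hφ0

/-- If `v` is nonzero on the component of `i`, only one simple root `k` there contributes to the
expansions of the root and of the coroot; eliminating its coefficient `n k` from the two values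
gives the identity. -/
lemma corootVal_dualVec_eq {b : P.Base} (hb : ∀ i ∈ b.support, 0 ≤ rootVal P i v) (i : ι) :
    (rootVal P i v = 0 ∧ corootVal P i (prPull P (dualVec P b φ v)) = 0) ∨
    ∃ k ∈ b.support, k ∈ component P i ∧ 0 < rootVal P k v ∧
      rootLen P i * rootVal P k v * corootVal P i (prPull P (dualVec P b φ v)) =
        rootLen P k * φ (rootVal P k v) * rootVal P i v := by
  obtain ⟨n, -, -, hin⟩ := b.exists_root_eq_sum_int i
  have h1 := rootVal_eq_sum hin v
  have h2 := rootLen_mul_corootVal hin (prPull P (dualVec P b φ v))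
  have hlen : (rootLen P i : ℚ) ≠ 0 := by exact_mod_cast (rootLen_pos P i).ne'
  by_cases hk : ∃ k ∈ b.support, k ∈ component P i ∧ 0 < rootVal P k v
  · right
    obtain ⟨k, hk, hki, hk0⟩ := hk
    refine ⟨k, hk, hki, hk0, ?_⟩
    have hzero (j : ι) (hj : j ∈ b.support) (hjk : j ≠ k) : n j = 0 ∨ rootVal P j v = 0 := by
      by_contra! h
      have hji := mem_component_of_coeff_ne_zero b hin hj h.1
      exact hjk (eq_of_mem_component hπ hv b hb hj hk
        (mem_component_trans (mem_component_symm hji) hki)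
        (lt_of_le_of_ne (hb j hj) h.2.symm) hk0)
    rw [Finset.sum_eq_single_of_mem k hk] at h1 h2
    · rw [corootVal_dualVec P b φ v hk] at h2
      rw [h1, mul_right_comm, h2]
      ring
    · intro j hj hjk
      rw [corootVal_dualVec P b φ v hj]
      rcases hzero j hj hjk with h | h
      · simp [h]
      · simp [h, hφ0]
    · intro j hj hjk
      rcases hzero j hj hjk with h | h
      · simp [h]
      · simp [h]
  · left
    push Not at hk
    have hzero (j : ι) (hj : j ∈ b.support) : n j = 0 ∨ rootVal P j v = 0 := by
      by_contra! h
      exact h.2 (le_antisymm (hk j hj (mem_component_of_coeff_ne_zero b hin hj h.1)) (hb j hj))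
    constructor
    · rw [h1]
      refine Finset.sum_eq_zero fun j hj ↦ ?_
      rcases hzero j hj with h | h <;> simp [h]
    · refine (mul_eq_zero.mp (h2.trans (Finset.sum_eq_zero fun j hj ↦ ?_))).resolve_left hlen
      rw [corootVal_dualVec P b φ v hj]
      rcases hzero j hj with h | h
      · simp [h]
      · simp [h, hφ0]

/-- The proportionality factor involves the base only through the length of `k` and the value of `v`
on it, which agree for both bases (the case `σ = 1`). -/
lemma dualVec_eq_dualVec {b b' : P.Base} (hb : ∀ i ∈ b.support, 0 ≤ rootVal P i v)
    (hb' : ∀ i ∈ b'.support, 0 ≤ rootVal P i v) : dualVec P b φ v = dualVec P b' φ v := by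
  refine eq_of_corootVal_adjoint_eq b fun i _ ↦ ?_
  rw [corootVal_adjoint, corootVal_adjoint]
  have hlen : (rootLen P i : ℚ) ≠ 0 := by exact_mod_cast (rootLen_pos P i).ne'
  rcases corootVal_dualVec_eq hπ hv hφ0 hb i with ⟨h1, h2⟩ | ⟨k, hk, hki, hk0, h⟩ <;>
  rcases corootVal_dualVec_eq hπ hv hφ0 hb' i with ⟨h1', h2'⟩ | ⟨k', hk', hki', hk0', h'⟩
  · rw [h2, h2']
  · rw [h1, mul_zero] at h'
    rw [h2, (mul_eq_zero.mp h').resolve_left (mul_ne_zero hlen hk0'.ne')]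
  · rw [h1', mul_zero] at h
    rw [h2', (mul_eq_zero.mp h).resolve_left (mul_ne_zero hlen hk0.ne')]
  · have hkk : k' ∈ component P (π 1 k) := by
      rw [map_one]
      exact mem_component_trans (mem_component_symm hki) hki'
    obtain ⟨e1, e2⟩ := rootVal_eq_and_rootLen_eq hπ hv hb hb' hk hk' hkk hk0 hk0'
    rw [← e1, ← e2, ← h] at h'
    exact (mul_left_cancel₀ (mul_ne_zero hlen hk0.ne') h').symm

include hφ in
lemma corootVal_dualVec_eq_zero_iff {b : P.Base} (hb : ∀ i ∈ b.support, 0 ≤ rootVal P i v)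
    (i : ι) : corootVal P i (prPull P (dualVec P b φ v)) = 0 ↔ rootVal P i v = 0 := by
  have hlen (i : ι) : (rootLen P i : ℚ) ≠ 0 := by exact_mod_cast (rootLen_pos P i).ne'
  rcases corootVal_dualVec_eq hπ hv hφ0 hb i with ⟨h1, h2⟩ | ⟨k, hk, hki, hk0, h⟩
  · simp [h1, h2]
  · rw [← mul_eq_zero_iff_left (mul_ne_zero (hlen i) hk0.ne'), h,
      mul_eq_zero_iff_left (mul_ne_zero (hlen k) (hφ _ hk0).ne')]

/-- The proportionality factor is the same at `i` and at `g (π σ i)`, so the trichotomy for `v`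
carries over. -/
lemma isQuasiConstantFun_dualVec {b : P.Base} (hb : ∀ i ∈ b.support, 0 ≤ rootVal P i v) :
    IsQuasiConstantFun P π fun i ↦ corootVal P i (prPull P (dualVec P b φ v)) := by
  intro i hi g hg σ
  beta_reduce at hi ⊢
  have hlen (i : ι) : (rootLen P i : ℚ) ≠ 0 := by exact_mod_cast (rootLen_pos P i).ne'
  have hlen' : rootLen P (g (π σ i)) = rootLen P i := by
    rw [rootLen_map (isPairingPreserving_of_mem hg), rootLen_map (hπ σ)]
  obtain ⟨k, hk, hki, hk0, h⟩ :=
    (corootVal_dualVec_eq hπ hv hφ0 hb i).resolve_left fun h ↦ hi h.2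
  have hi0 : rootVal P i v ≠ 0 := by
    intro h0
    rw [h0, mul_zero] at h
    exact hi ((mul_eq_zero.mp h).resolve_left (mul_ne_zero (hlen i) hk0.ne'))
  rcases corootVal_dualVec_eq hπ hv hφ0 hb (g (π σ i)) with ⟨-, h2⟩ | ⟨k', hk', hki', hk0', h'⟩
  · exact .inl h2
  have hkk : k' ∈ component P (π σ k) :=
    mem_component_trans (mem_component_trans
      (mem_component_symm (map_mem_component (hπ σ) hki))
      (mem_component_of_mem_reflectionGroup hg _)) hki'
  obtain ⟨e1, e2⟩ := rootVal_eq_and_rootLen_eq hπ hv hb hb hk hk' hkk hk0 hk0'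
  rw [← e1, ← e2, hlen'] at h'
  refine (hv i hi0 g hg σ).imp (fun h0 ↦ ?_) (Or.imp (fun h0 ↦ ?_) fun h0 ↦ ?_) <;>
    beta_reduce at h0 <;> rw [h0] at h'
  · rw [mul_zero] at h'
    exact (mul_eq_zero.mp h').resolve_left (mul_ne_zero (hlen i) hk0.ne')
  · rw [← h] at h'
    exact mul_left_cancel₀ (mul_ne_zero (hlen i) hk0.ne') h'
  · rw [mul_neg, ← h, ← mul_neg] at h'
    exact mul_left_cancel₀ (mul_ne_zero (hlen i) hk0.ne') h'

end DualVector

/-! ### Adapted bases, Levi subgroups and the four properties. -/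

section DualRays

variable {ι X Y Γ : Type*} [AddCommGroup X] [AddCommGroup Y] [Group Γ]

lemma mem_cent_span₀_iff (P : RootDatum ι X Y) (v : ℚ ⊗[ℤ] Y) (i : ι) :
    i ∈ (cent P (span₀ v)).roots ↔ rootVal P i v = 0 := by
  constructor
  · intro h
    obtain ⟨n, hn, y, hy⟩ := exists_pos_smul_eq_one_tmul v
    have hn' : (0 : ℚ) < n := by exact_mod_cast hn
    have h1 := h y ⟨n, hn'.le, hy.symm⟩
    have h2 := congrArg (rootVal P i) hy
    rw [map_smul, rootVal, ratExt_tmul, h1, Int.cast_zero, zero_mul] at h2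
    exact (smul_eq_zero.mp h2).resolve_left hn'.ne'
  · rintro h y ⟨q, -, hq⟩
    have h2 := congrArg (rootVal P i) hq
    rw [map_smul, h, smul_zero, rootVal, ratExt_tmul, mul_one] at h2
    exact_mod_cast h2

lemma isDominantCochar_span₀_iff (P : RootDatum ι X Y) (b : P.Base) (v : ℚ ⊗[ℤ] Y) :
    IsDominantCochar P b (span₀ v) ↔ ∀ i ∈ b.support, 0 ≤ rootVal P i v := by
  constructor
  · exact fun h ↦ h v (self_mem_span₀ v)
  · rintro h - ⟨q, hq, rfl⟩ i hi
    rw [map_smul]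
    exact mul_nonneg hq (h i hi)

lemma isDominantCochar_flip (P : RootDatum ι X Y) (b : P.Base) (s : Set (ℚ ⊗[ℤ] X)) :
    IsDominantCochar P.flip b.flip s ↔ IsDominantChar P b s := Iff.rfl

/-- Fundamental coweights are dominant. With `isAdapted_of_dominant`, adapted and dominant bases
coincide for quasi-constant rays. -/
lemma IsAdapted.rootVal_nonneg {P : RootDatum ι X Y} {b : P.Base} {v : ℚ ⊗[ℤ] Y}
    (h : IsAdapted P b (span₀ v)) : ∀ i ∈ b.support, 0 ≤ rootVal P i v := by
  intro i hi
  rcases h i with h | ⟨k, -, -, -, ⟨q, hq, rfl⟩, h1, h2⟩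
  · exact (h v (self_mem_span₀ v) i (mem_component_self P i)).ge
  · simp only [map_smul, smul_eq_mul] at h1 h2
    have hq0 : 0 < q := lt_of_le_of_ne hq fun h ↦ by simp [← h] at h1
    by_cases hik : i = k
    · subst hik
      exact (pos_of_mul_pos_right (h1 ▸ one_pos) hq).le
    · have := h2 i hi (mem_component_self P i) hik
      exact ((mul_eq_zero.mp this).resolve_left hq0.ne').ge

lemma corootVal_baseChange_characters {P : RootDatum ι X Y} (L : Levi P) {i : ι}
    (hi : i ∈ L.roots) (x : ℚ ⊗[ℤ] L.characters) :
    corootVal P i (L.characters.subtype.baseChange ℚ x) = 0 := by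
  have : P.coroot' i ∘ₗ L.characters.subtype = 0 := by
    ext ⟨χ, hχ⟩
    simp only [Levi.characters, Submodule.mem_iInf] at hχ
    exact hχ i hi
  rw [corootVal, ratExt_baseChange, this]
  exact congrArg (fun φ ↦ φ x) (show ratExt (0 : L.characters →ₗ[ℤ] ℤ) = 0 by ext; simp)

/-- A positive lattice multiple of `x` is itself a character of `L`. -/
lemma isRestrictionOfRay_span₀ {P : RootDatum ι X Y} (L : Levi P) {x : ℚ ⊗[ℤ] X} (hx : x ≠ 0)
    (h : ∀ i ∈ L.roots, corootVal P i x = 0) : IsRestrictionOfRay L (span₀ x) := by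
  obtain ⟨n, hn, χ, hχ⟩ := exists_pos_smul_eq_one_tmul x
  have hn' : (0 : ℚ) < n := by exact_mod_cast hn
  have hmem : χ ∈ L.characters := by
    simp only [Levi.characters, Submodule.mem_iInf]
    intro i hi
    have h1 := congrArg (corootVal P i) hχ
    rw [map_smul, h i hi, smul_zero, corootVal, ratExt_tmul, mul_one] at h1
    exact_mod_cast h1.symm
  have hmap : L.characters.subtype.baseChange ℚ ((1 : ℚ) ⊗ₜ[ℤ] ⟨χ, hmem⟩) = (n : ℚ) • x := by
    rw [hχ]
    rfl
  refine ⟨span₀ ((1 : ℚ) ⊗ₜ[ℤ] ⟨χ, hmem⟩), ⟨_, fun h0 ↦ ?_, rfl⟩, ?_⟩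
  · rw [h0, map_zero] at hmap
    exact smul_ne_zero hn'.ne' hx hmap.symm
  · rw [image_span₀, hmap, span₀_smul hn']

variable [Finite ι] [Module.Finite ℤ X] {P : RootDatum ι X Y} [P.IsReduced] {π : Γ →* (ι ≃ ι)}
  (hπ : ∀ σ, IsPairingPreserving P (π σ)) {v : ℚ ⊗[ℤ] Y}
  (hv : IsQuasiConstantFun P π fun i ↦ rootVal P i v)

include hπ hv

lemma exists_simple_rootVal_pos {b : P.Base} (hb : ∀ i ∈ b.support, 0 ≤ rootVal P i v) {i : ι}
    (hi : rootVal P i v ≠ 0) : ∃ k ∈ b.support, k ∈ component P i ∧ 0 < rootVal P k v := by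
  -- The choice of `φ` is immaterial: only the simple root `k` is extracted.
  obtain ⟨k, hk, hki, hk0, -⟩ := (corootVal_dualVec_eq hπ hv (φ := id) rfl hb i).resolve_left
    fun h ↦ hi h.1
  exact ⟨k, hk, hki, hk0⟩

/-- A base for which a quasi-constant ray is dominant is adapted to it. -/
theorem isAdapted_of_dominant {b : P.Base} (hb : ∀ i ∈ b.support, 0 ≤ rootVal P i v) :
    IsAdapted P b (span₀ v) := by
  intro c
  by_cases h : ∃ j ∈ component P c, rootVal P j v ≠ 0
  · right
    obtain ⟨j, hj, hj0⟩ := h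
    obtain ⟨k, hk, hkj, hk0⟩ := exists_simple_rootVal_pos hπ hv hb hj0
    have hkc := mem_component_trans hj hkj
    refine ⟨k, hk, hkc, (rootVal P k v)⁻¹ • v, ⟨_, (inv_pos.mpr hk0).le, rfl⟩, ?_, ?_⟩
    · rw [map_smul, smul_eq_mul, inv_mul_cancel₀ hk0.ne']
    · intro l hl hlc hlk
      have : rootVal P l v = 0 := by
        by_contra h0
        exact hlk (eq_of_mem_component hπ hv b hb hl hk
          (mem_component_trans (mem_component_symm hlc) hkc)
          (lt_of_le_of_ne (hb l hl) (Ne.symm h0)) hk0)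
      rw [map_smul, this, smul_zero]
  · left
    push Not at h
    rintro - ⟨q, -, rfl⟩ j hj
    rw [map_smul, h j hj, smul_zero]

/-- The dual ray attached to a weighting `φ` of the simple factors has the four properties. -/
theorem hasDualProperties_dualVec {φ : ℚ → ℚ} (hφ0 : φ 0 = 0) (hφ : ∀ q, 0 < q → 0 < φ q)
    {b : P.Base} (hb : ∀ i ∈ b.support, 0 ≤ rootVal P i v) (hne : ∃ i, rootVal P i v ≠ 0) :
    HasDualProperties P π (span₀ v) (span₀ (dualVec P b φ v)) := by
  have hzero := corootVal_dualVec_eq_zero_iff hπ hv hφ0 hφ hb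
  have hqc := isQuasiConstantFun_dualVec hπ hv hφ0 hb
  have hpull : prPull P (dualVec P b φ v) ≠ 0 := by
    obtain ⟨i, hi⟩ := hne
    intro h
    rw [ne_eq, ← hzero, h, map_zero] at hi
    exact hi rfl
  constructor
  · refine (isQuasiConstantCharRay_iff _ _ _).mpr ⟨_, fun h ↦ hpull (by rw [h, map_zero]), rfl, ?_⟩
    simp only [corootVal_adjoint]
    exact hqc
  · rw [image_span₀]
    exact (isQuasiConstantCharRay_iff _ _ _).mpr ⟨_, hpull, rfl, hqc⟩
  · rw [image_span₀]
    exact isRestrictionOfRay_span₀ _ hpull fun i hi ↦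
      (hzero i).mpr ((mem_cent_span₀_iff P v i).mp hi)
  -- Characters of `L` vanish on the coroots of `L`, and by `hzero` the dual vector and `v` vanish
  -- on the same indices.
  · rintro L ⟨t, -, ht⟩ i hi
    rw [image_span₀] at ht
    obtain ⟨z, -, hz⟩ := ht ▸ self_mem_span₀ (prPull P (dualVec P b φ v))
    rw [mem_cent_span₀_iff, ← hzero, ← hz]
    exact corootVal_baseChange_characters L hi z

/-- `dualRay` is a union over all adapted bases, whose members all coincide. -/
lemma dualRay_span₀ {b : P.Base} (hb : ∀ i ∈ b.support, 0 ≤ rootVal P i v) :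
    dualRay P (span₀ v) = prPull P '' dualRayAd P b (span₀ v) := by
  ext χ
  constructor
  · rintro ⟨b', hb', hχ⟩
    rwa [dualRayAd_span₀, dualVec_eq_dualVec hπ hv rfl hb hb'.rootVal_nonneg, ← dualRayAd_span₀]
  · exact fun h ↦ ⟨b, isAdapted_of_dominant hπ hv hb, h⟩

/-- Transitivity makes all nonzero values of `v` on simple roots equal, so the two dual vectors
differ by this positive factor. -/
lemma dualRayAd_eq_unitDualRayAd {b : P.Base} (hb : ∀ i ∈ b.support, 0 ≤ rootVal P i v)
    (hne : ∃ i, rootVal P i v ≠ 0) (htrans : ∀ i j, ∃ σ, j ∈ component P (π σ i)) :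
    dualRayAd P b (span₀ v) = unitDualRayAd P b (span₀ v) := by
  obtain ⟨i, hi⟩ := hne
  obtain ⟨k, hk, -, hk0⟩ := exists_simple_rootVal_pos hπ hv hb hi
  rw [dualRayAd_span₀, unitDualRayAd_span₀,
    ← span₀_smul hk0 (dualVec P b nonzeroIndicator v)]
  congr 1
  rw [dualVec, dualVec, Finset.smul_sum]
  refine Finset.sum_congr rfl fun j _ ↦ ?_
  by_cases hj : rootVal P j v = 0
  · simp [hj, nonzeroIndicator_zero]
  · obtain ⟨σ, hσ⟩ := htrans k j
    have heq := (rootVal_eq_and_rootLen_eq hπ hv hb hb hk j.2 hσ hk0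
      (lt_of_le_of_ne (hb j j.2) (Ne.symm hj))).1
    rw [nonzeroIndicator_of_ne hj, one_smul, heq, id]

omit hv in
lemma dualRay_eq {r : Set (ℚ ⊗[ℤ] Y)} (hr : IsQuasiConstantCocharRay P π r) {b : P.Base}
    (hb : IsDominantCochar P b r) : dualRay P r = prPull P '' dualRayAd P b r := by
  obtain ⟨v, -, rfl, hv⟩ := (isQuasiConstantCocharRay_iff _ _ _).mp hr
  exact dualRay_span₀ hπ hv ((isDominantCochar_span₀_iff P b v).mp hb)

end DualRays

/-! ### Bijections for semisimple root data. -/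

section Semisimple

variable {ι X Y Γ : Type*} [AddCommGroup X] [AddCommGroup Y] [Group Γ]

lemma isReduced_flip [Finite ι] (P : RootDatum ι X Y) [P.IsReduced] : P.flip.IsReduced := by
  have := isTorsionFree_weight P
  have := isTorsionFree_weight P.flip
  infer_instance

lemma isPairingPreserving_flip {P : RootDatum ι X Y} {e : ι ≃ ι} (he : IsPairingPreserving P e) :
    IsPairingPreserving P.flip e := fun i j ↦ he j i

/-- A lattice multiple of `v` pairs to zero with all roots, hence with all characters as the roots
span, and the pairing is perfect. -/
lemma eq_zero_of_rootVal_eq_zero {P : RootDatum ι X Y} (hP : IsSemisimple P) (b : P.Base)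
    {v : ℚ ⊗[ℤ] Y} (h : ∀ i ∈ b.support, rootVal P i v = 0) : v = 0 := by
  have hall (i : ι) : rootVal P i v = 0 := by
    obtain ⟨n, -, -, hn⟩ := b.exists_root_eq_sum_int i
    rw [rootVal_eq_sum hn]
    exact Finset.sum_eq_zero fun j hj ↦ by rw [h j hj, mul_zero]
  obtain ⟨n, hn, y, hy⟩ := exists_pos_smul_eq_one_tmul v
  have hroot (i : ι) : P.root' i y = 0 := by
    have h1 := congrArg (rootVal P i) hy
    rw [map_smul, hall, smul_zero, rootVal, ratExt_tmul, mul_one] at h1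
    exact_mod_cast h1.symm
  have hker : ratExt (P.toLinearMap.flip y) = 0 := by
    refine LinearMap.ker_eq_top.mp (top_le_iff.mp (hP ▸ Submodule.span_le.mpr ?_))
    rintro - ⟨i, rfl⟩
    have : P.toLinearMap (P.root i) y = 0 := hroot i
    simp [this]
  have hy0 : y = 0 := by
    have hinj : Function.Injective P.toLinearMap.flip :=
      (LinearMap.IsPerfPair.bijective_right P.toLinearMap).injective
    refine (map_eq_zero_iff _ hinj).mp (LinearMap.ext fun x ↦ ?_)
    have h1 : ratExt (P.toLinearMap.flip y) ((1 : ℚ) ⊗ₜ[ℤ] x) = 0 := by rw [hker]; rfl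
    rw [ratExt_tmul, mul_one] at h1
    exact_mod_cast h1
  rw [hy0, TensorProduct.tmul_zero] at hy
  exact (smul_eq_zero.mp hy).resolve_left (by exact_mod_cast hn.ne')

variable [Finite ι] [Module.Finite ℤ X]

/-- Semisimplicity makes `prPull` surjective, which reduces the claim to the adjoint root datum. -/
lemma eq_zero_of_corootVal_eq_zero {P : RootDatum ι X Y} (hP : IsSemisimple P) (b : P.Base)
    {x : ℚ ⊗[ℤ] X} (h : ∀ i ∈ b.support, corootVal P i x = 0) : x = 0 := by
  have hx : x ∈ LinearMap.range (prPull P) := by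
    have : (⊤ : Submodule ℚ (ℚ ⊗[ℤ] X)) ≤ LinearMap.range (prPull P) := by
      rw [← hP, Submodule.span_le]
      rintro - ⟨i, rfl⟩
      exact ⟨(1 : ℚ) ⊗ₜ[ℤ] P.rootSpanMem ℤ i, rfl⟩
    exact this trivial
  obtain ⟨z, rfl⟩ := hx
  rw [eq_of_corootVal_adjoint_eq b (x := z) (y := 0) fun i hi ↦ by
    rw [corootVal_adjoint, h i hi, map_zero], map_zero]

variable {P : RootDatum ι X Y} {π : Γ →* (ι ≃ ι)}

/-- Assuming separation `hsep` in place of semisimplicity lets the lemma apply to `P.flip` without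
proving that datum semisimple. -/
lemma mapsTo_dualRay_of_dominant [P.IsReduced] (hπ : ∀ σ, IsPairingPreserving P (π σ))
    (b : P.Base) (hsep : ∀ v, (∀ i ∈ b.support, rootVal P i v = 0) → v = 0) :
    Set.MapsTo (fun r ↦ prPull P '' dualRayAd P b r)
      {r | IsQuasiConstantCocharRay P π r ∧ IsDominantCochar P b r}
      {s | IsQuasiConstantCharRay P π s ∧ IsDominantChar P b s} := by
  rintro r ⟨hr, hb⟩
  obtain ⟨v, hv0, rfl, hv⟩ := (isQuasiConstantCocharRay_iff _ _ _).mp hr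
  rw [isDominantCochar_span₀_iff] at hb
  have hne : ∃ i, rootVal P i v ≠ 0 := by
    by_contra! h
    exact hv0 (hsep v fun i _ ↦ h i)
  refine ⟨?_, ?_⟩
  · beta_reduce
    rw [dualRayAd_span₀]
    exact (hasDualProperties_dualVec hπ hv rfl (fun _ ↦ id) hb hne).quasiConstant
  · beta_reduce
    rw [dualRayAd_span₀, image_span₀, ← isDominantCochar_flip, isDominantCochar_span₀_iff]
    intro i hi
    exact (corootVal_dualVec P b id v hi).symm ▸ hb i hi

/-- The double dual of `v` has the same values as `v` on the simple roots. -/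
lemma dualRay_flip_dualRay [Module.Finite ℤ Y] (b : P.Base)
    (hsep : ∀ v, (∀ i ∈ b.support, rootVal P i v = 0) → v = 0)
    {r : Set (ℚ ⊗[ℤ] Y)} (hr : IsRay r) :
    prPull P.flip '' dualRayAd P.flip b.flip (prPull P '' dualRayAd P b r) = r := by
  obtain ⟨v, -, rfl⟩ := hr
  rw [dualRayAd_span₀, image_span₀, dualRayAd_span₀, image_span₀]
  congr 1
  refine sub_eq_zero.mp (hsep _ fun i hi ↦ ?_)
  rw [map_sub, sub_eq_zero]
  exact (corootVal_dualVec P.flip b.flip id _ hi).trans (corootVal_dualVec P b id v hi)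

variable [Module.Finite ℤ Y] [P.IsReduced] (hπ : ∀ σ, IsPairingPreserving P (π σ))
  (hP : IsSemisimple P)

include hπ hP

theorem bijOn_dualRay_of_dominant (b : P.Base) :
    Set.BijOn (fun r ↦ prPull P '' dualRayAd P b r)
      {r | IsQuasiConstantCocharRay P π r ∧ IsDominantCochar P b r}
      {s | IsQuasiConstantCharRay P π s ∧ IsDominantChar P b s} := by
  have := isReduced_flip P
  have hsep (v : ℚ ⊗[ℤ] Y) : (∀ i ∈ b.support, rootVal P i v = 0) → v = 0 :=
    eq_zero_of_rootVal_eq_zero hP b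
  have hsep' (v : ℚ ⊗[ℤ] X) : (∀ i ∈ b.flip.support, rootVal P.flip i v = 0) → v = 0 :=
    eq_zero_of_corootVal_eq_zero hP b
  refine Set.InvOn.bijOn (f' := fun s ↦ prPull P.flip '' dualRayAd P.flip b.flip s)
    ⟨fun r hr ↦ dualRay_flip_dualRay b hsep hr.1.1,
      fun s hs ↦ dualRay_flip_dualRay b.flip hsep' hs.1.1⟩
    (mapsTo_dualRay_of_dominant hπ b hsep) fun s hs ↦ ?_
  have := mapsTo_dualRay_of_dominant (fun σ ↦ isPairingPreserving_flip (hπ σ)) b.flip hsep'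
    (x := s) ⟨(isQuasiConstantCocharRay_flip P π s).mpr hs.1, hs.2⟩
  exact ⟨(isQuasiConstantCharRay_flip P π _).mp this.1, this.2⟩

/-- Every quasi-constant ray is dominant for some base, and its dual ray is dominant for the same
base, so the dominant case supplies the inverse `dualRay P.flip`. -/
theorem bijOn_dualRay :
    Set.BijOn (dualRay P) {r | IsQuasiConstantCocharRay P π r}
      {s | IsQuasiConstantCharRay P π s} := by
  have := isReduced_flip P
  have hbase {r : Set (ℚ ⊗[ℤ] Y)} (hr : IsQuasiConstantCocharRay P π r) :
      ∃ b : P.Base, IsDominantCochar P b r := by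
    obtain ⟨v, -, rfl, hv⟩ := (isQuasiConstantCocharRay_iff _ _ _).mp hr
    obtain ⟨b, hb⟩ := exists_base_dominant P v
    exact ⟨b, (isDominantCochar_span₀_iff P b v).mpr hb⟩
  have hbase' {s : Set (ℚ ⊗[ℤ] X)} (hs : IsQuasiConstantCharRay P π s) :
      ∃ b : P.Base, IsDominantChar P b s := by
    obtain ⟨v, -, rfl, hv⟩ := (isQuasiConstantCharRay_iff _ _ _).mp hs
    obtain ⟨b, hb⟩ := exists_base_dominant P.flip v
    exact ⟨b.flip, (isDominantCochar_span₀_iff P.flip b v).mpr hb⟩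
  have hinv : Set.LeftInvOn (dualRay P.flip) (dualRay P) {r | IsQuasiConstantCocharRay P π r} := by
    intro r hr
    obtain ⟨b, hb⟩ := hbase hr
    have h := (bijOn_dualRay_of_dominant hπ hP b).mapsTo ⟨hr, hb⟩
    rw [dualRay_eq hπ hr hb, dualRay_eq (fun σ ↦ isPairingPreserving_flip (hπ σ))
      ((isQuasiConstantCocharRay_flip P π _).mpr h.1) (b := b.flip) h.2]
    exact dualRay_flip_dualRay b (fun _ ↦ eq_zero_of_rootVal_eq_zero hP b) hr.1
  refine ⟨fun r hr ↦ ?_, hinv.injOn, fun s hs ↦ ?_⟩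
  · obtain ⟨b, hb⟩ := hbase hr
    rw [dualRay_eq hπ hr hb]
    exact ((bijOn_dualRay_of_dominant hπ hP b).mapsTo ⟨hr, hb⟩).1
  · obtain ⟨b, hb⟩ := hbase' hs
    obtain ⟨r, ⟨hr, hrb⟩, hrs⟩ := (bijOn_dualRay_of_dominant hπ hP b).surjOn ⟨hs, hb⟩
    exact ⟨r, hr, (dualRay_eq hπ hr hrb).trans hrs⟩

end Semisimple

end QuasiConstant

end

theorem proposition3p3p3 {ι X Y Γ : Type*} [AddCommGroup X] [AddCommGroup Y] [Group Γ]
    [Finite ι] [Module.Finite ℤ X] [Module.Finite ℤ Y]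
    (P : RootDatum ι X Y) [P.IsReduced] (ρ : Γ →* P.Aut) :
    -- the construction is possible and independent of the choice of simple roots, and the dual
    -- rays it gives have the four properties
    (∀ r : Set (ℚ ⊗[ℤ] Y),
      IsQuasiConstantCocharRay P (galPerm P ρ) r →
      ¬ IsCentral P r →
      (∃ b : P.Base, IsAdapted P b r) ∧
      (∀ b : P.Base, IsDominantCochar P b r → IsAdapted P b r) ∧
      (∀ b b' : P.Base, IsAdapted P b r → IsAdapted P b' r →
        dualRayAd P b r = dualRayAd P b' r ∧
        unitDualRayAd P b r = unitDualRayAd P b' r) ∧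
      (∀ b : P.Base, IsAdapted P b r →
        HasDualProperties P (galPerm P ρ) r
          (dualRayAd P b r) ∧
        HasDualProperties P (galPerm P ρ) r
          (unitDualRayAd P b r) ∧
        dualRay P r = prPull P '' dualRayAd P b r ∧
        -- the two dual rays agree if `Γ` permutes the simple factors transitively
        ((∀ i j : ι, ∃ σ : Γ,
            j ∈ component P (galPerm P ρ σ i)) →
          dualRayAd P b r = unitDualRayAd P b r))) ∧
    -- the bijection for semisimple root data
    (IsSemisimple P →
      Set.BijOn (dualRay P)
        {r | IsQuasiConstantCocharRay P (galPerm P ρ) r}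
        {s | IsQuasiConstantCharRay P (galPerm P ρ) s} ∧
      ∀ b : P.Base, Set.BijOn
        (fun r ↦ prPull P '' dualRayAd P b r)
        {r | IsQuasiConstantCocharRay P (galPerm P ρ) r ∧
          IsDominantCochar P b r}
        {s | IsQuasiConstantCharRay P (galPerm P ρ) s ∧
          IsDominantChar P b s}) := by
  have hπ := isPairingPreserving_galPerm P ρ
  refine ⟨fun r hr hcentral ↦ ?_,
    fun hP ↦ ⟨bijOn_dualRay hπ hP, bijOn_dualRay_of_dominant hπ hP⟩⟩
  obtain ⟨v, -, rfl, hv⟩ := (isQuasiConstantCocharRay_iff _ _ _).mp hr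
  have hne : ∃ i, rootVal P i v ≠ 0 := by
    by_contra! h
    refine hcentral ?_
    rintro - ⟨q, -, rfl⟩ i
    rw [map_smul, h i, smul_zero]
  have hpos (q : ℚ) (hq : 0 < q) : 0 < nonzeroIndicator q := by
    rw [nonzeroIndicator_of_ne hq.ne']
    exact one_pos
  refine ⟨?_, fun b hb ↦ ?_, fun b b' hb hb' ↦ ?_, fun b hb ↦ ⟨?_, ?_, ?_, fun htrans ↦ ?_⟩⟩
  · obtain ⟨b, hb⟩ := exists_base_dominant P v
    exact ⟨b, isAdapted_of_dominant hπ hv hb⟩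
  · exact isAdapted_of_dominant hπ hv ((isDominantCochar_span₀_iff P b v).mp hb)
  · simp only [dualRayAd_span₀, unitDualRayAd_span₀]
    exact ⟨by rw [dualVec_eq_dualVec hπ hv rfl hb.rootVal_nonneg hb'.rootVal_nonneg],
      by rw [dualVec_eq_dualVec hπ hv nonzeroIndicator_zero hb.rootVal_nonneg hb'.rootVal_nonneg]⟩
  · rw [dualRayAd_span₀]
    exact hasDualProperties_dualVec hπ hv rfl (fun _ ↦ id) hb.rootVal_nonneg hne
  · rw [unitDualRayAd_span₀]
    exact hasDualProperties_dualVec hπ hv nonzeroIndicator_zero hpos hb.rootVal_nonneg hne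
  · exact dualRay_span₀ hπ hv hb.rootVal_nonneg
  · exact dualRayAd_eq_unitDualRayAd hπ hv hb.rootVal_nonneg hne htrans
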